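/- Let $X=(x_n)_{n\ge 1}$ be a sequence of positive real numbers such that, for some constant $c>0$, $x_{n+1}-x_n\ge c$ for all $n\ge1$. For $N\ge 1$ let $$E^*(X,N)=\#\{(n_1,n_2,n_3,n_4)\in\{1,\dots,N\}^4:\ |x_{n_1}+x_{n_2}-x_{n_3}-x_{n_4}|<1\},$$ and for $\alpha\in\mathbb R$ and $N\ge 2$ let $$\delta_{\min}^{\alpha}(N)=\min\{\|\alpha x_m-\alpha x_n\|:\ 1\le m,n\le N,\ m\ne n\},\qquad \|t\|=\min_{k\in\mathbb Z}|t-k|.$$ Assume that $E^*(X,N)=N^{2+o(1)}$ as $N\to\infty$. Let $\kappa\ge 2$ and $m(\kappa)$ be real numbers such that for every $\varepsilon>0$, as $T\to\infty$, $$\frac1T\int_0^T\left|\zeta\left(\tfrac12+it\right)\right|^{\kappa}\,dt\ \ll_{\varepsilon}\ T^{m(\kappa)+\varepsilon}.$$ Then for Lebesgue-almost every $\alpha\in\mathbb R$, $$\delta_{\min}^{\alpha}(N)<\frac{1}{N^{\frac{2\kappa-4}{\kappa+4m(\kappa)}-o(1)}}\qquad(N\to\infty),$$ where the rate of decay of $o(1)$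 may depend on $\alpha$. In particular, if the moment bound holds with $\kappa=12$ and $m(12)=1$ (which is Heath-Brown's twelfth moment bound), then $\delta_{\min}^{\alpha}(N)<N^{-5/4+o(1)}$ for almost every $\alpha\in\mathbb R$. -/

import Mathlib

open Filter Topology MeasureTheory Asymptotics

noncomputable section

/-- The distance `‖t‖ = min_{k ∈ ℤ} |t - k|` of a real number to the nearest integer. -/
def distNearestInt (t : ℝ) : ℝ := |t - round t|

theorem distNearestInt_isLeast (t : ℝ) :
    IsLeast (Set.range fun k : ℤ => |t - (k : ℝ)|) (distNearestInt t) :=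
  ⟨⟨round t, rfl⟩, by rintro _ ⟨k, rfl⟩; exact round_le t k⟩

/-- The set of gaps `‖x_m - x_n‖`, over `1 ≤ m, n ≤ N` with `m ≠ n`. -/
def gapSet (x : ℕ → ℝ) (N : ℕ) : Set ℝ :=
  {d | ∃ m ∈ Finset.Icc 1 N, ∃ n ∈ Finset.Icc 1 N, m ≠ n ∧ d = distNearestInt (x m - x n)}

/-- The minimal gap `δ_min((x_n)_{n ≥ 1}, N)`; for `N ≥ 2` the infimum is a minimum. -/
def minGap (x : ℕ → ℝ) (N : ℕ) : ℝ := sInf (gapSet x N)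

theorem minGap_isLeast (x : ℕ → ℝ) {N : ℕ} (hN : 2 ≤ N) :
    IsLeast (gapSet x N) (minGap x N) := by
  have hfin : (gapSet x N).Finite := by
    refine ((Finset.Icc 1 N ×ˢ Finset.Icc 1 N).finite_toSet.image
      (fun p : ℕ × ℕ => distNearestInt (x p.1 - x p.2))).subset ?_
    rintro d ⟨m, hm, n, hn, -, rfl⟩
    exact ⟨(m, n), Finset.mem_coe.2 (Finset.mk_mem_product hm hn), rfl⟩
  have hne : (gapSet x N).Nonempty :=
    ⟨_, 1, Finset.mem_Icc.2 ⟨le_rfl, by omega⟩, 2, Finset.mem_Icc.2 ⟨by omega, hN⟩,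
      by omega, rfl⟩
  exact ⟨hne.csInf_mem hfin, fun _ hd => csInf_le hfin.bddBelow hd⟩

/-- The metric minimal gap `δ_min^α(N)`: the minimal gap of `(α x_n)_{n ≥ 1}`. -/
def metricMinGap (x : ℕ → ℝ) (α : ℝ) (N : ℕ) : ℝ := minGap (fun n => α * x n) N

open Classical in
/-- The additive energy `E*(X, N, γ)`: the number of `(n₁, n₂, n₃, n₄) ∈ [1, N]⁴` with
`|x_{n₁} + x_{n₂} - x_{n₃} - x_{n₄}| < γ`. -/
def addEnergyAt (x : ℕ → ℝ) (N : ℕ) (γ : ℝ) : ℕ :=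
  ((Finset.Icc 1 N ×ˢ Finset.Icc 1 N ×ˢ Finset.Icc 1 N ×ˢ Finset.Icc 1 N).filter
    fun q : ℕ × ℕ × ℕ × ℕ => |x q.1 + x q.2.1 - x q.2.2.1 - x q.2.2.2| < γ).card

/-- `E*(X, N) = E*(X, N, 1)`. -/
def addEnergy (x : ℕ → ℝ) (N : ℕ) : ℕ := addEnergyAt x N 1

/-- `(1/T) ∫₀ᵀ |ζ(1/2 + it)|^κ dt ≪_ε T^{m + ε}` as `T → ∞`, for every `ε > 0`. -/
def ZetaMomentBound (κ m : ℝ) : Prop :=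
  ∀ ε : ℝ, 0 < ε →
    (fun T : ℝ => (1 / T) * ∫ t in (0 : ℝ)..T, ‖riemannZeta (1 / 2 + Complex.I * (t : ℂ))‖ ^ κ)
      =O[atTop] (fun T : ℝ => T ^ (m + ε))

/-- For almost all `α`, `δ_min^α(N) < 1 / N^{e - o(1)}` as `N → ∞`; the `o(1)` may depend
on `α`. -/
def AEMinGapBound (x : ℕ → ℝ) (e : ℝ) : Prop :=
  ∀ᵐ α : ℝ ∂volume, ∃ o : ℕ → ℝ, Tendsto o atTop (𝓝 0) ∧
    ∀ᶠ N : ℕ in atTop, metricMinGap x α N < 1 / (N : ℝ) ^ (e - o N)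

end

/-! Fix `α` and consider the differences `z_p = x_m - x_n` with `n < m ≤ N`; there are about N² of
them. If every `α z_p` keeps distance at least `δ` from the integers, then a cosine polynomial with
nonnegative coefficients, concentrated near the integers and of degree N^a slightly above 1/δ, is
small at all these points. Its nonconstant part is then a negative multiple of the constant term at
each `p`. By Chebyshev under a Gaussian law for `α` (`measure_forall_le_distNearestInt_le`) this is
rare as soon as, for each dyadic K ≤ N^a, the number of solutions of `|j z_p - l z_q| ≤ H` with j, l
in [K, 2K) is at most N^(4-c) for some c > 0.

To count solutions, take logarithms: log j + log z_p and log l + log z_q agree to within 1/T, with T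
about K². Sorting the z_p into logarithmic windows of width 1/T, with weights v_k
(`exists_window_weights`), bounds the count by a Gaussian quadratic form, which is dominated by the
mean square over |t| ≲ T of a smoothed sum of j^(-it), j near K, times ∑ v_k e^(-itk/T). The
smoothed sum is at most √K times a local average of |ζ(1/2 + it)|, plus a pole term concentrated at
bounded t.

In `exists_logForm_le` the part of ζ with |ζ|² ≤ L is paired with the mean square of the window sum,
controlled by ∑ v_k² and hence by the additive energy. The rest is paired with the κ-th moment and
the trivial bound ∑ v_k ≤ N². Up to powers N^ε this gives N⁴K²/T + K L N² + K L^(1-κ/2) N⁴ T^m.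
Taking K = N^a, T = N^(2a), L = N^(2-a), the third term saves a power over N⁴ exactly when a(κ + 4m)
< 2κ - 4; small changes of the exponents make the other two save as well
(`exists_sum_card_dilate_le`).

The resulting measure bound is summable over N = 2^l, so Borel–Cantelli applies, and monotonicity of
the minimal gap in N fills in the other N. -/

open ProbabilityTheory

/-! ### The zeta function for Re s > 0 via truncated Dirichlet series -/

/-- The integral `∫_1^∞ {x} x^(-s-1) dx`. -/
noncomputable def fractIntegral (s : ℂ) : ℂ :=
  ∫ x in Set.Ioi (1 : ℝ), ((Int.fract x : ℝ) : ℂ) * (x : ℂ) ^ (-s - 1)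

theorem complex_cpow_one_add (w : ℂ) {z : ℂ} (hz : z ≠ 0) : z ^ (1 + w) = z * z ^ w := by
  rw [Complex.cpow_add _ _ hz, Complex.cpow_one]

theorem norm_fract_le_one (x : ℝ) : ‖((Int.fract x : ℝ) : ℂ)‖ ≤ 1 := by
  rw [Complex.norm_real, Real.norm_of_nonneg (Int.fract_nonneg x)]
  exact (Int.fract_lt_one x).le

theorem integrableOn_fract_mul_cpow {s : ℂ} (hs : 0 < s.re) {c : ℝ} (hc : 0 < c) :
    IntegrableOn (fun x : ℝ => ((Int.fract x : ℝ) : ℂ) * (x : ℂ) ^ (-s - 1)) (Set.Ioi c) := by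
  have h : IntegrableOn (fun x : ℝ => (x : ℂ) ^ (-s - 1)) (Set.Ioi c) :=
    integrableOn_Ioi_cpow_of_lt (by simp; linarith) hc
  refine Integrable.bdd_mul (c := 1) h ?_ (Eventually.of_forall norm_fract_le_one)
  exact (Complex.measurable_ofReal.comp measurable_fract).aestronglyMeasurable

/-- The integral is a Mellin transform at -s of a bounded function vanishing on (0, 1], hence
holomorphic where Re(-s) < 0. -/
theorem differentiableOn_fractIntegral : DifferentiableOn ℂ fractIntegral {s | 0 < s.re} := by
  intro s hs
  have hs : 0 < s.re := hs
  set f : ℝ → ℂ := Set.indicator (Set.Ioi 1) (fun x => ((Int.fract x : ℝ) : ℂ)) with hf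
  have heq : fractIntegral = fun s => mellin f (-s) := by
    ext s
    rw [mellin, fractIntegral, ← integral_indicator measurableSet_Ioi,
      ← integral_indicator measurableSet_Ioi]
    congr 1
    ext x
    by_cases hx : x ∈ Set.Ioi (1 : ℝ)
    · have hx0 : x ∈ Set.Ioi (0 : ℝ) := lt_trans (zero_lt_one' ℝ) hx
      simp [hf, hx, hx0, mul_comm]
    · have h0 : f x = 0 := Set.indicator_of_notMem hx _
      rw [Set.indicator_of_notMem hx]
      by_cases hx0 : x ∈ Set.Ioi (0 : ℝ)
      · rw [Set.indicator_of_mem hx0, h0, smul_zero]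
      · rw [Set.indicator_of_notMem hx0]
  have hfm : Measurable f :=
    (Complex.measurable_ofReal.comp measurable_fract).indicator measurableSet_Ioi
  have hfb : ∀ x, ‖f x‖ ≤ 1 := fun x =>
    (norm_indicator_le_norm_self _ _).trans (norm_fract_le_one x)
  have hd : DifferentiableAt ℂ (mellin f) (-s) := by
    refine mellin_differentiableAt_of_isBigO_rpow (a := 0) (b := -s.re - 1) ?_ ?_ ?_ ?_ ?_
    · refine LocallyIntegrable.locallyIntegrableOn ?_ _
      have h1 : LocallyIntegrable (fun _ : ℝ => (1 : ℝ)) volume := locallyIntegrable_const 1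
      exact h1.mono hfm.aestronglyMeasurable (Eventually.of_forall fun x => by simpa using hfb x)
    · simpa using (isBigO_of_le (g := fun _ : ℝ => (1 : ℝ)) atTop (fun x => by simpa using hfb x))
    · simpa using hs
    · refine (EventuallyEq.isBigO (f₂ := fun _ => (0 : ℂ)) ?_).trans (isBigO_zero _ _)
      filter_upwards [Ioo_mem_nhdsGT (zero_lt_one' ℝ)] with x hx
      simp [hf, hx.2.le]
    · simp
  rw [heq]
  exact (hd.comp s differentiable_neg.differentiableAt).differentiableWithinAt

/-- Partial summation, with ⌊t⌋ = t - {t}. -/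
theorem riemannZeta_eq_fractIntegral_of_one_lt_re {s : ℂ} (hs : 1 < s.re) :
    riemannZeta s = s / (s - 1) - s * fractIntegral s := by
  have h1 := LSeries_eq_mul_integral' (fun _ => (1 : ℂ)) (r := 1) zero_le_one (s := s) hs (by
    simpa using isBigO_refl _ _)
  have hz : LSeries (fun _ => (1 : ℂ)) s = riemannZeta s := LSeries_one_eq_riemannZeta hs
  rw [hz] at h1
  have hint : IntegrableOn (fun x : ℝ => (x : ℂ) ^ (-s)) (Set.Ioi 1) :=
    integrableOn_Ioi_cpow_of_lt (by simpa using hs) zero_lt_one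
  have h2 : ∫ t in Set.Ioi (1 : ℝ), (∑ k ∈ Finset.Icc 1 ⌊t⌋₊, (1 : ℂ)) * (t : ℂ) ^ (-(s + 1))
      = (∫ t in Set.Ioi (1 : ℝ), (t : ℂ) ^ (-s)) - fractIntegral s := by
    rw [fractIntegral, ← integral_sub hint (integrableOn_fract_mul_cpow (by linarith) zero_lt_one)]
    refine setIntegral_congr_fun measurableSet_Ioi fun t ht => ?_
    have ht : (1 : ℝ) < t := ht
    have ht0 : (t : ℂ) ≠ 0 := by exact_mod_cast (by linarith : t ≠ 0)
    have hfl : ((⌊t⌋₊ : ℕ) : ℂ) = (t : ℂ) - ((Int.fract t : ℝ) : ℂ) := by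
      have : (⌊t⌋₊ : ℝ) = t - Int.fract t := by
        rw [natCast_floor_eq_intCast_floor (by linarith : (0:ℝ) ≤ t), Int.self_sub_fract]
      exact_mod_cast congrArg (fun r : ℝ => (r : ℂ)) this
    have hpow : (t : ℂ) ^ (-s) = t * (t : ℂ) ^ (-s - 1) := by
      rw [← complex_cpow_one_add _ ht0]; congr 1; ring
    simp only [Finset.sum_const, Nat.card_Icc, Nat.add_sub_cancel, nsmul_eq_mul, mul_one]
    rw [hfl, hpow, neg_add']
    ring
  rw [h1, h2, integral_Ioi_cpow_of_lt (by simpa using hs) zero_lt_one]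
  have : s - 1 ≠ 0 := by
    intro h; rw [sub_eq_zero.1 h] at hs; simp at hs
  have h3 : -s + 1 ≠ 0 := by rwa [neg_add_eq_sub, ← neg_sub, neg_ne_zero]
  simp only [Complex.ofReal_one, Complex.one_cpow]
  field_simp
  ring

/-- Analytic continuation: multiplied by s - 1, both sides are holomorphic on Re s > 0 and they
agree near 2. -/
theorem riemannZeta_eq_fractIntegral {s : ℂ} (hs : 0 < s.re) (hs1 : s ≠ 1) :
    riemannZeta s = s / (s - 1) - s * fractIntegral s := by
  have hopen : IsOpen {s : ℂ | 0 < s.re} := isOpen_lt continuous_const Complex.continuous_re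
  have hconv : Convex ℝ {s : ℂ | 0 < s.re} := convex_halfSpace_re_gt 0
  have hf : AnalyticOnNhd ℂ riemannZeta₁ {s | 0 < s.re} :=
    differentiable_riemannZeta₁.differentiableOn.analyticOnNhd hopen
  have hg : AnalyticOnNhd ℂ (fun s => s - s * (s - 1) * fractIntegral s) {s | 0 < s.re} := by
    refine DifferentiableOn.analyticOnNhd ?_ hopen
    have := differentiableOn_fractIntegral
    fun_prop
  have heq := hf.eqOn_of_preconnected_of_eventuallyEq hg hconv.isPreconnected
    (z₀ := 2) (by simp) (eventuallyEq_of_mem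
      ((isOpen_lt continuous_const Complex.continuous_re).mem_nhds
        (show (2 : ℂ) ∈ {s : ℂ | 1 < s.re} by simp)) fun z hz => by
      have hz : 1 < z.re := hz
      have hz1 : z ≠ 1 := by rintro rfl; simp at hz
      have h := riemannZeta_eq_inv_sub_mul hz1
      have hz2 : z - 1 ≠ 0 := sub_ne_zero.2 hz1
      rw [riemannZeta_eq_fractIntegral_of_one_lt_re hz] at h
      field_simp at h
      rw [← h]; ring)
  have h := riemannZeta_eq_inv_sub_mul hs1
  have hz2 : s - 1 ≠ 0 := sub_ne_zero.2 hs1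
  rw [h, heq hs]
  field_simp

theorem setIntegral_fract_mul_cpow_step {s : ℂ} (hs1 : s ≠ 1) {n : ℕ} (hn : 1 ≤ n) :
    s * ∫ x in Set.Ioc (n : ℝ) (n + 1), ((Int.fract x : ℝ) : ℂ) * (x : ℂ) ^ (-s - 1) =
      ((n + 1 : ℕ) : ℂ) ^ (1 - s) / (1 - s) - (n : ℂ) ^ (1 - s) / (1 - s)
        - ((n + 1 : ℕ) : ℂ) ^ (-s) := by
  have hn0 : (0 : ℝ) < n := by exact_mod_cast hn
  have hle : (n : ℝ) ≤ n + 1 := by linarith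
  have h1s : 1 - s ≠ 0 := sub_ne_zero.2 hs1.symm
  have hcong : ∫ x in Set.Ioc (n : ℝ) (n + 1), ((Int.fract x : ℝ) : ℂ) * (x : ℂ) ^ (-s - 1) =
      ∫ x in Set.Ioc (n : ℝ) (n + 1), ((x : ℂ) - n) * (x : ℂ) ^ (-s - 1) := by
    rw [integral_Ioc_eq_integral_Ioo, integral_Ioc_eq_integral_Ioo]
    refine setIntegral_congr_fun measurableSet_Ioo fun x hx => ?_
    have : Int.fract x = x - n := by
      rw [Int.fract_eq_iff]
      exact ⟨by linarith [hx.1], by linarith [hx.2], n, by simp⟩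
    simp only [this, Complex.ofReal_sub, Complex.ofReal_natCast]
  rw [hcong, ← integral_const_mul, ← intervalIntegral.integral_of_le hle]
  -- On [n, n+1) the fractional part is x - n, which gives an explicit antiderivative.
  have hderiv : ∀ x ∈ Set.uIcc (n : ℝ) (n + 1), HasDerivAt
      (fun x : ℝ => s * ((x : ℂ) ^ (1 - s) / (1 - s)) + n * (x : ℂ) ^ (-s))
      (s * (((x : ℂ) - n) * (x : ℂ) ^ (-s - 1))) x := by
    intro x hx
    rw [Set.uIcc_of_le hle] at hx
    have hx0 : 0 < x := lt_of_lt_of_le hn0 hx.1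
    have hsl : (x : ℂ) ∈ Complex.slitPlane := Complex.ofReal_mem_slitPlane.2 hx0
    have hxc : (x : ℂ) ≠ 0 := by exact_mod_cast hx0.ne'
    have hA : HasDerivAt (fun x : ℝ => (x : ℂ) ^ (1 - s)) ((1 - s) * (x : ℂ) ^ (1 - s - 1)) x := by
      simpa using ((hasDerivAt_id (x : ℂ)).cpow_const (c := 1 - s) hsl).comp_ofReal
    have hB : HasDerivAt (fun x : ℝ => (x : ℂ) ^ (-s)) ((-s) * (x : ℂ) ^ (-s - 1)) x := by
      simpa using ((hasDerivAt_id (x : ℂ)).cpow_const (c := -s) hsl).comp_ofReal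
    convert! ((hA.div_const (1 - s)).const_mul s).add (hB.const_mul (n : ℂ)) using 1
    have hpow : (x : ℂ) ^ (1 - s - 1) = x * (x : ℂ) ^ (-s - 1) := by
      rw [← complex_cpow_one_add _ hxc]; congr 1; ring
    rw [hpow]
    field_simp
    ring
  have hcont : ContinuousOn (fun x : ℝ => s * (((x : ℂ) - n) * (x : ℂ) ^ (-s - 1)))
      (Set.uIcc (n : ℝ) (n + 1)) := by
    intro x hx
    rw [Set.uIcc_of_le hle] at hx
    have hx0 : 0 < x := lt_of_lt_of_le hn0 hx.1
    have : ContinuousAt (fun x : ℝ => (x : ℂ) ^ (-s - 1)) x :=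
      ContinuousAt.cpow Complex.continuous_ofReal.continuousAt continuousAt_const
        (Complex.ofReal_mem_slitPlane.2 hx0)
    have h2 : ContinuousAt (fun x : ℝ => (x : ℂ) - n) x := by fun_prop
    exact ((h2.mul this).const_mul s).continuousWithinAt
  rw [intervalIntegral.integral_eq_sub_of_hasDerivAt hderiv hcont.intervalIntegrable]
  have hnc : (n : ℂ) ≠ 0 := by exact_mod_cast hn0.ne'
  have hnc1 : ((n : ℂ) + 1) ≠ 0 := by exact_mod_cast (by positivity : (n : ℝ) + 1 ≠ 0)
  push_cast
  rw [sub_eq_add_neg 1 s, complex_cpow_one_add _ hnc, complex_cpow_one_add _ hnc1,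
    ← sub_eq_add_neg]
  field_simp
  ring

/-- Truncated Dirichlet series of `ζ`, corrected by its main term. -/
theorem sum_cpow_sub_eq_riemannZeta_add {s : ℂ} (hs : 0 < s.re) (hs1 : s ≠ 1) {n : ℕ}
    (hn : 1 ≤ n) :
    ∑ j ∈ Finset.Icc 1 n, (j : ℂ) ^ (-s) - (n : ℂ) ^ (1 - s) / (1 - s) =
      riemannZeta s +
        s * ∫ x in Set.Ioi (n : ℝ), ((Int.fract x : ℝ) : ℂ) * (x : ℂ) ^ (-s - 1) := by
  have h1s : 1 - s ≠ 0 := sub_ne_zero.2 hs1.symm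
  have h1s' : s - 1 ≠ 0 := sub_ne_zero.2 hs1
  induction n, hn using Nat.le_induction with
  | base =>
    rw [riemannZeta_eq_fractIntegral hs hs1, fractIntegral]
    simp only [Finset.Icc_self, Finset.sum_singleton, Nat.cast_one, Complex.one_cpow]
    field_simp
    ring
  | succ n hn ih =>
    have hn0 : (0 : ℝ) < n := by exact_mod_cast hn
    have hsplit : ∫ x in Set.Ioi (n : ℝ), ((Int.fract x : ℝ) : ℂ) * (x : ℂ) ^ (-s - 1) =
        (∫ x in Set.Ioc (n : ℝ) (n + 1), ((Int.fract x : ℝ) : ℂ) * (x : ℂ) ^ (-s - 1)) +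
        ∫ x in Set.Ioi ((n + 1 : ℕ) : ℝ), ((Int.fract x : ℝ) : ℂ) * (x : ℂ) ^ (-s - 1) := by
      have hI := integrableOn_fract_mul_cpow hs hn0
      rw [← Set.Ioc_union_Ioi_eq_Ioi (by linarith : (n : ℝ) ≤ n + 1)] at hI ⊢
      rw [setIntegral_union (Set.Ioc_disjoint_Ioi le_rfl) measurableSet_Ioi
        (hI.mono_set Set.subset_union_left) (hI.mono_set Set.subset_union_right)]
      push_cast
      rfl
    rw [hsplit, mul_add, setIntegral_fract_mul_cpow_step hs1 hn] at ih
    rw [Finset.sum_Icc_succ_top (by omega)]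
    linear_combination ih

theorem norm_sum_cpow_sub_sub_riemannZeta_le {s : ℂ} (hs : 0 < s.re) (hs1 : s ≠ 1) {n : ℕ}
    (hn : 1 ≤ n) :
    ‖∑ j ∈ Finset.Icc 1 n, (j : ℂ) ^ (-s) - (n : ℂ) ^ (1 - s) / (1 - s) - riemannZeta s‖ ≤
      ‖s‖ * ((n : ℝ) ^ (-s.re) / s.re) := by
  have hn0 : (0 : ℝ) < n := by exact_mod_cast hn
  rw [sum_cpow_sub_eq_riemannZeta_add hs hs1 hn, add_sub_cancel_left, norm_mul]
  refine mul_le_mul_of_nonneg_left ?_ (norm_nonneg _)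
  have h : ∫ x in Set.Ioi (n : ℝ), x ^ (-s.re - 1) = (n : ℝ) ^ (-s.re) / s.re := by
    rw [integral_Ioi_rpow_of_lt (by linarith) hn0]
    simp [neg_div, div_neg]
  rw [← h]
  refine norm_integral_le_of_norm_le (integrableOn_Ioi_rpow_of_lt (by linarith) hn0) ?_
  refine (ae_restrict_mem measurableSet_Ioi).mono fun x hx => ?_
  have hx0 : 0 < x := hn0.trans hx
  rw [norm_mul, Complex.norm_cpow_eq_rpow_re_of_pos hx0]
  refine (mul_le_of_le_one_left (by positivity) (norm_fract_le_one x)).trans (le_of_eq ?_)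
  simp

/-! ### Gaussian smoothing along the critical line -/

theorem integral_cexp_mul_I_gaussianReal (v : NNReal) (a : ℝ) :
    ∫ y, Complex.exp (a * y * Complex.I) ∂(gaussianReal 0 v) = (Real.exp (-(v * a ^ 2) / 2) : ℝ) := by
  have h := charFun_gaussianReal (μ := 0) (v := v) a
  rw [charFun_apply_real] at h
  rw [h]
  push_cast
  congr 1
  ring

/-- The point `1/2 + it` on the critical line. -/
noncomputable def critPt (t : ℝ) : ℂ := 1 / 2 + Complex.I * t

@[simp] theorem critPt_re (t : ℝ) : (critPt t).re = 1 / 2 := by simp [critPt]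
@[simp] theorem critPt_im (t : ℝ) : (critPt t).im = t := by simp [critPt]

theorem critPt_ne_one (t : ℝ) : critPt t ≠ 1 := fun h => by
  have := congrArg Complex.re h
  norm_num at this

theorem continuous_critPt : Continuous critPt := by unfold critPt; fun_prop

theorem norm_critPt_le (t : ℝ) : ‖critPt t‖ ≤ 1 / 2 + |t| := by
  have := Complex.norm_le_abs_re_add_abs_im (critPt t)
  simpa [abs_of_pos] using this

theorem continuous_zeta_critPt : Continuous fun t : ℝ => riemannZeta (critPt t) := by
  refine continuous_iff_continuousAt.2 fun t => ?_
  exact (differentiableAt_riemannZeta (critPt_ne_one t)).continuousAt.comp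
    continuous_critPt.continuousAt

/-- The truncation at n = 1 already yields linear growth, which is enough for integrability against
Gaussians. -/
theorem norm_zeta_critPt_le (t : ℝ) : ‖riemannZeta (critPt t)‖ ≤ 4 + 2 * |t| := by
  have h := norm_sum_cpow_sub_sub_riemannZeta_le (s := critPt t) (by simp) (critPt_ne_one t)
    (n := 1) le_rfl
  simp only [Finset.Icc_self, Finset.sum_singleton, Nat.cast_one, Complex.one_cpow,
    Real.one_rpow, critPt_re, one_div_one_div] at h
  have h1 : (1 / 2 : ℝ) ≤ ‖1 - critPt t‖ := by
    have := Complex.abs_re_le_norm (1 - critPt t)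
    norm_num at this
    linarith
  have h2 : ‖1 / (1 - critPt t)‖ ≤ 2 := by
    rw [norm_div, norm_one, div_le_iff₀ (by linarith)]
    linarith
  have h3 := norm_critPt_le t
  have h4 : ‖riemannZeta (critPt t)‖ ≤ ‖(1 : ℂ)‖ + ‖1 / (1 - critPt t)‖
      + ‖1 - 1 / (1 - critPt t) - riemannZeta (critPt t)‖ := by
    have := norm_sub_le (1 - 1 / (1 - critPt t)) (1 - 1 / (1 - critPt t) - riemannZeta (critPt t))
    have h5 := norm_sub_le (1 : ℂ) (1 / (1 - critPt t))
    rw [sub_sub_cancel] at this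
    linarith
  rw [norm_one] at h4
  linarith

/-- The logarithmically smoothed weight `(j/K)^(-1/2) exp(-log²(j/K)/2)`. -/
noncomputable def logWeight (K : ℝ) (j : ℕ) : ℝ :=
  Real.sqrt K * ((j : ℝ) ^ (-(1 / 2) : ℝ) * Real.exp (-(Real.log K - Real.log j) ^ 2 / 2))

/-- The smoothed Dirichlet polynomial approximating `∑ j ^ (-it)` over `j` of size about `K`. -/
noncomputable def smoothSum (K : ℝ) (n : ℕ) (t : ℝ) : ℂ :=
  ∑ j ∈ Finset.Icc 1 n, (logWeight K j : ℂ) * Complex.exp (-(t * Real.log j : ℝ) * Complex.I)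

theorem natCast_cpow_neg_critPt {j : ℕ} (hj : 1 ≤ j) (t : ℝ) :
    (j : ℂ) ^ (-critPt t) =
      ((j : ℝ) ^ (-(1 / 2) : ℝ) : ℝ) * Complex.exp (-(t * Real.log j : ℝ) * Complex.I) := by
  have hj0 : (0 : ℝ) < j := by exact_mod_cast hj
  have hjc : (j : ℂ) ≠ 0 := by exact_mod_cast hj0.ne'
  rw [Complex.cpow_def_of_ne_zero hjc, Real.rpow_def_of_pos hj0, ← Complex.natCast_log]
  push_cast
  rw [← Complex.exp_add, critPt]
  congr 1
  ring

/-- The phase e^(iy log K) recentres the Gaussian characteristic function at j = K, so averaging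
over vertical shifts y localises the Dirichlet series near K. -/
theorem integral_cexp_mul_cpow_neg_critPt (K : ℝ) {j : ℕ} (hj : 1 ≤ j) (t : ℝ) :
    Real.sqrt K * ∫ y, Complex.exp (Real.log K * y * Complex.I) * (j : ℂ) ^ (-critPt (t + y))
      ∂(gaussianReal 0 1) =
    (logWeight K j : ℂ) * Complex.exp (-(t * Real.log j : ℝ) * Complex.I) := by
  have h : ∀ y : ℝ, Complex.exp (Real.log K * y * Complex.I) * (j : ℂ) ^ (-critPt (t + y)) =
      (((j : ℝ) ^ (-(1 / 2) : ℝ) : ℝ) * Complex.exp (-(t * Real.log j : ℝ) * Complex.I)) *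
        Complex.exp ((Real.log K - Real.log j : ℝ) * y * Complex.I) := by
    intro y
    rw [natCast_cpow_neg_critPt hj, mul_left_comm, mul_assoc (((j : ℝ) ^ (-(1 / 2) : ℝ) : ℝ) : ℂ),
      ← Complex.exp_add, ← Complex.exp_add]
    congr 2
    push_cast
    ring
  simp_rw [h]
  rw [integral_const_mul, integral_cexp_mul_I_gaussianReal, logWeight]
  push_cast
  simp only [one_mul]
  ring

theorem integrable_abs_gaussianReal (v : NNReal) : Integrable (fun y : ℝ => |y|) (gaussianReal 0 v) :=
  ((memLp_id_gaussianReal (μ := 0) (v := v) 1).integrable (by simp)).norm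

theorem integrable_of_norm_le_linear {E : Type*} [NormedAddCommGroup E] {f : ℝ → E} {v : NNReal}
    (hf : AEStronglyMeasurable f (gaussianReal 0 v)) (A B : ℝ) (h : ∀ y, ‖f y‖ ≤ A + B * |y|) :
    Integrable f (gaussianReal 0 v) :=
  Integrable.mono' ((integrable_const A).add ((integrable_abs_gaussianReal v).const_mul B)) hf
    (Eventually.of_forall h)

theorem integrable_cexp_mul_cpow_neg_critPt (K : ℝ) {j : ℕ} (hj : 1 ≤ j) (t : ℝ) :
    Integrable (fun y : ℝ => Complex.exp (Real.log K * y * Complex.I) *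
      (j : ℂ) ^ (-critPt (t + y))) (gaussianReal 0 1) := by
  refine integrable_of_norm_le_linear ?_ 1 0 fun y => ?_
  · have hjc : (j : ℂ) ≠ 0 := by exact_mod_cast (by omega : j ≠ 0)
    refine Continuous.aestronglyMeasurable ?_
    have : Continuous fun y : ℝ => (j : ℂ) ^ (-critPt (t + y)) := by
      refine Continuous.const_cpow ?_ (Or.inl hjc)
      exact (continuous_critPt.comp (by fun_prop)).neg
    exact Continuous.mul (by fun_prop) this
  · have h1 : ‖(j : ℂ) ^ (-critPt (t + y))‖ ≤ 1 := by
      rw [Complex.norm_natCast_cpow_of_pos (by omega)]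
      exact Real.rpow_le_one_of_one_le_of_nonpos (by exact_mod_cast hj) (by simp)
    have h2 : ‖Complex.exp (Real.log K * y * Complex.I)‖ = 1 := by
      rw [← Complex.ofReal_mul, Complex.norm_exp_ofReal_mul_I]
    rw [norm_mul, h2, one_mul]
    simpa using h1

theorem smoothSum_eq_integral (K : ℝ) (n : ℕ) (t : ℝ) :
    smoothSum K n t = Real.sqrt K * ∫ y, Complex.exp (Real.log K * y * Complex.I) *
      ∑ j ∈ Finset.Icc 1 n, (j : ℂ) ^ (-critPt (t + y)) ∂(gaussianReal 0 1) := by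
  simp_rw [Finset.mul_sum]
  rw [integral_finsetSum _ fun j hj =>
    integrable_cexp_mul_cpow_neg_critPt K (Finset.mem_Icc.1 hj).1 t, Finset.mul_sum, smoothSum]
  exact Finset.sum_congr rfl fun j hj =>
    (integral_cexp_mul_cpow_neg_critPt K (Finset.mem_Icc.1 hj).1 t).symm

/-- The integrand of the main term of the smoothed sum. -/
noncomputable def mainIntegrand (L t u : ℝ) : ℂ :=
  Complex.exp ((1 / 2 - t * Complex.I) * u) * (Real.exp (-(L - u) ^ 2 / 2) : ℝ)

theorem norm_mainIntegrand (L t u : ℝ) :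
    ‖mainIntegrand L t u‖ = Real.exp (u / 2) * Real.exp (-(L - u) ^ 2 / 2) := by
  rw [mainIntegrand, norm_mul, Complex.norm_exp, Complex.norm_real, Real.norm_of_nonneg (by positivity)]
  simp
  ring

theorem mainIntegrand_eq (L t u : ℝ) :
    mainIntegrand L t u = Complex.exp ((-(1 / 2) : ℂ) * (u : ℂ) ^ 2 +
      (1 / 2 - t * Complex.I + L) * u + (-(L : ℂ) ^ 2 / 2)) := by
  rw [mainIntegrand, Complex.ofReal_exp, ← Complex.exp_add]
  congr 1
  push_cast
  ring

theorem integrable_mainIntegrand (L t : ℝ) : Integrable (mainIntegrand L t) := by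
  simp_rw [funext (mainIntegrand_eq L t)]
  exact integrable_cexp_quadratic' (by norm_num) _ _

/-- Completing the square produces the factor e^(-t²/2), which confines the contribution of the pole
of ζ to bounded t. -/
theorem norm_integral_mainIntegrand {K : ℝ} (hK : 0 < K) (t : ℝ) :
    ‖∫ u, mainIntegrand (Real.log K) t u‖ =
      Real.sqrt (2 * Real.pi) * Real.exp (1 / 8) * Real.sqrt K * Real.exp (-t ^ 2 / 2) := by
  simp_rw [mainIntegrand_eq]
  rw [integral_cexp_quadratic (by norm_num), norm_mul, Complex.norm_exp]
  have h1 : ‖((Real.pi : ℂ) / -(-(1 / 2) : ℂ)) ^ (1 / 2 : ℂ)‖ = Real.sqrt (2 * Real.pi) := by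
    have : ((Real.pi : ℂ) / -(-(1 / 2) : ℂ)) = ((2 * Real.pi : ℝ) : ℂ) := by
      push_cast; ring
    rw [this, Complex.norm_cpow_eq_rpow_re_of_pos (by positivity), Real.sqrt_eq_rpow]
    norm_num
  have h2 : Real.sqrt K = Real.exp (Real.log K / 2) := by
    rw [Real.exp_half, Real.exp_log hK]
  have h3 : -((Real.log K : ℝ) : ℂ) ^ 2 / 2 - (1 / 2 - t * Complex.I + (Real.log K : ℝ)) ^ 2 /
      (4 * -(1 / 2)) = (1 / 8 + Real.log K / 2 - t ^ 2 / 2 : ℝ) +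
        (-((1 / 2 + Real.log K) * t) : ℝ) * Complex.I := by
    push_cast
    linear_combination (t ^ 2 / 2 : ℂ) * Complex.I_sq
  rw [h1, h2, h3, show ((1 / 8 + Real.log K / 2 - t ^ 2 / 2 : ℝ) +
        (-((1 / 2 + Real.log K) * t) : ℝ) * Complex.I : ℂ).re =
          1 / 8 + Real.log K / 2 - t ^ 2 / 2 by
            rw [Complex.add_re, Complex.ofReal_re, Complex.re_ofReal_mul]; simp, mul_assoc, mul_assoc, ← Real.exp_add, ← Real.exp_add]
  congr 2
  ring

theorem natCast_cpow_div_eq_setIntegral {n : ℕ} (hn : 1 ≤ n) (t : ℝ) :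
    (n : ℂ) ^ (1 - critPt t) / (1 - critPt t) =
      ∫ u in Set.Iic (Real.log n), Complex.exp ((1 - critPt t) * u) := by
  have hnc : (n : ℂ) ≠ 0 := by exact_mod_cast (by omega : n ≠ 0)
  rw [integral_exp_mul_complex_Iic (by norm_num), Complex.cpow_def_of_ne_zero hnc,
    Complex.natCast_log, mul_comm]

/-- The term n^(1-s)/(1-s) has size about √n pointwise. Written as an integral of e^((1-s)u) over u
≤ log n and averaged by Fubini, it becomes a truncated Gaussian integral that converges as n → ∞. -/
theorem integral_cexp_mul_cpow_div (K : ℝ) {n : ℕ} (hn : 1 ≤ n) (t : ℝ) :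
    ∫ y, Complex.exp (Real.log K * y * Complex.I) *
      ((n : ℂ) ^ (1 - critPt (t + y)) / (1 - critPt (t + y))) ∂(gaussianReal 0 1) =
    ∫ u in Set.Iic (Real.log n), mainIntegrand (Real.log K) t u := by
  simp_rw [natCast_cpow_div_eq_setIntegral hn, ← integral_const_mul]
  have hpt : ∀ y u : ℝ, Complex.exp (Real.log K * y * Complex.I) *
      Complex.exp ((1 - critPt (t + y)) * u) = Complex.exp ((1 / 2 - t * Complex.I) * u) *
        Complex.exp ((Real.log K - u : ℝ) * y * Complex.I) := by
    intro y u
    rw [← Complex.exp_add, ← Complex.exp_add, critPt]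
    congr 1
    push_cast
    ring
  rw [integral_integral_swap]
  · refine integral_congr_ae (Eventually.of_forall fun u => ?_)
    simp only [hpt]
    rw [integral_const_mul, integral_cexp_mul_I_gaussianReal, mainIntegrand]
    simp
  · have h1 : Integrable (fun u : ℝ => Real.exp (1 / 2 * u))
        (volume.restrict (Set.Iic (Real.log n))) := integrableOn_exp_mul_Iic (by norm_num) _
    have h2 := (integrable_const (μ := gaussianReal 0 1) (1 : ℝ)).mul_prod h1
    refine h2.mono' ?_ (Eventually.of_forall fun p => ?_)
    · simp only [Function.uncurry_def, hpt]
      refine Continuous.aestronglyMeasurable ?_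
      fun_prop
    · simp only [Function.uncurry, hpt]
      rw [norm_mul, ← Complex.ofReal_mul, Complex.norm_exp_ofReal_mul_I, Complex.norm_exp]
      simp

/-- The truncated Dirichlet series is the pole term plus ζ plus a remainder O(|s| n^(-1/2)); each is
averaged against a phase of modulus 1. -/
theorem norm_smoothSum_le (K : ℝ) {n : ℕ} (hn : 1 ≤ n) (t : ℝ) :
    ‖smoothSum K n t‖ ≤ Real.sqrt K * (‖∫ u in Set.Iic (Real.log n), mainIntegrand (Real.log K) t u‖
      + ∫ y, ‖riemannZeta (critPt (t + y))‖ ∂(gaussianReal 0 1)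
      + 2 * (n : ℝ) ^ (-(1 / 2) : ℝ) * (1 / 2 + |t| + ∫ y, |y| ∂(gaussianReal 0 1))) := by
  set μ := gaussianReal 0 1
  set e : ℝ → ℂ := fun y => Complex.exp (Real.log K * y * Complex.I) with he
  have hen : ∀ y, ‖e y‖ = 1 := fun y => by
    simp only [he]; rw [← Complex.ofReal_mul, Complex.norm_exp_ofReal_mul_I]
  have hec : Continuous e := by fun_prop
  have hcr : Continuous fun y : ℝ => critPt (t + y) := continuous_critPt.comp (by fun_prop)
  have hnc : (n : ℂ) ≠ 0 := by exact_mod_cast (by omega : n ≠ 0)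
  set r : ℝ → ℂ := fun y => ∑ j ∈ Finset.Icc 1 n, (j : ℂ) ^ (-critPt (t + y)) -
    (n : ℂ) ^ (1 - critPt (t + y)) / (1 - critPt (t + y)) - riemannZeta (critPt (t + y)) with hr
  have hrn : ∀ y, ‖r y‖ ≤ 2 * (n : ℝ) ^ (-(1 / 2) : ℝ) * (1 / 2 + |t| + |y|) := by
    intro y
    have h := norm_sum_cpow_sub_sub_riemannZeta_le (s := critPt (t + y)) (by simp)
      (critPt_ne_one _) hn
    have h2 := norm_critPt_le (t + y)
    have h3 := abs_add_le t y
    rw [critPt_re] at h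
    refine h.trans ?_
    have h4 : (0 : ℝ) ≤ (n : ℝ) ^ (-(1 / 2) : ℝ) := by positivity
    have h5 : (n : ℝ) ^ (-(1 / 2) : ℝ) / (1 / 2) = 2 * (n : ℝ) ^ (-(1 / 2) : ℝ) := by ring
    rw [h5, mul_comm]
    exact mul_le_mul_of_nonneg_left (by linarith) (by positivity)
  have hzc : Continuous fun y => riemannZeta (critPt (t + y)) :=
    continuous_zeta_critPt.comp (by fun_prop : Continuous fun y : ℝ => t + y)
  have hmc : Continuous fun y => (n : ℂ) ^ (1 - critPt (t + y)) / (1 - critPt (t + y)) := by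
    refine Continuous.div (Continuous.const_cpow (by fun_prop) (Or.inl hnc)) (by fun_prop) ?_
    exact fun y => sub_ne_zero.2 (critPt_ne_one _).symm
  have hrc : Continuous r := by
    refine ((continuous_finsetSum _ fun j hj => ?_).sub hmc).sub hzc
    have hjc : (j : ℂ) ≠ 0 := by
      have := (Finset.mem_Icc.1 hj).1
      exact_mod_cast (by omega : j ≠ 0)
    exact Continuous.const_cpow hcr.neg (Or.inl hjc)
  have hri : Integrable (fun y => e y * r y) μ := by
    refine integrable_of_norm_le_linear (hec.mul hrc).aestronglyMeasurable
      (2 * (n : ℝ) ^ (-(1 / 2) : ℝ) * (1 / 2 + |t|)) (2 * (n : ℝ) ^ (-(1 / 2) : ℝ)) fun y => ?_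
    rw [norm_mul, hen, one_mul]
    linarith [hrn y]
  have hzi : Integrable (fun y => e y * riemannZeta (critPt (t + y))) μ := by
    refine integrable_of_norm_le_linear (hec.mul hzc).aestronglyMeasurable
      (4 + 2 * |t|) 2 fun y => ?_
    rw [norm_mul, hen, one_mul]
    linarith [norm_zeta_critPt_le (t + y), abs_add_le t y]
  have hmi : Integrable (fun y => e y *
      ((n : ℂ) ^ (1 - critPt (t + y)) / (1 - critPt (t + y)))) μ := by
    refine integrable_of_norm_le_linear (hec.mul hmc).aestronglyMeasurable
      ((n : ℝ) ^ (1 / 2 : ℝ) * 2) 0 fun y => ?_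
    have h1 : (1 / 2 : ℝ) ≤ ‖1 - critPt (t + y)‖ := by
      have := Complex.abs_re_le_norm (1 - critPt (t + y))
      norm_num at this
      linarith
    rw [norm_mul, hen, one_mul, norm_div, Complex.norm_natCast_cpow_of_pos (by omega)]
    have h2 : (1 - critPt (t + y)).re = 1 / 2 := by norm_num
    rw [h2, zero_mul, add_zero, div_le_iff₀ (by linarith)]
    have : (0 : ℝ) ≤ (n : ℝ) ^ (1 / 2 : ℝ) := by positivity
    nlinarith
  have hsplit : ∀ y, e y * ∑ j ∈ Finset.Icc 1 n, (j : ℂ) ^ (-critPt (t + y)) =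
      e y * ((n : ℂ) ^ (1 - critPt (t + y)) / (1 - critPt (t + y))) +
        e y * riemannZeta (critPt (t + y)) + e y * r y := fun y => by simp only [hr]; ring
  have hsum := smoothSum_eq_integral K n t
  have hmain := integral_cexp_mul_cpow_div K hn t
  change smoothSum K n t = Real.sqrt K * ∫ y, e y * _ ∂μ at hsum
  change ∫ y, e y * _ ∂μ = _ at hmain
  simp_rw [hsplit] at hsum
  have hmzi : Integrable (fun y => e y * ((n : ℂ) ^ (1 - critPt (t + y)) / (1 - critPt (t + y))) +
      e y * riemannZeta (critPt (t + y))) μ := hmi.add hzi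
  rw [integral_add hmzi hri, integral_add hmi hzi, hmain] at hsum
  rw [hsum, norm_mul, Complex.norm_real, Real.norm_of_nonneg (Real.sqrt_nonneg _)]
  refine mul_le_mul_of_nonneg_left ?_ (Real.sqrt_nonneg _)
  refine (norm_add₃_le).trans (add_le_add (add_le_add le_rfl ?_) ?_)
  · refine (norm_integral_le_integral_norm _).trans (le_of_eq ?_)
    simp [hen]
  · have hab : Integrable (fun y : ℝ => |y|) μ := integrable_abs_gaussianReal 1
    have : 2 * (n : ℝ) ^ (-(1 / 2) : ℝ) * (1 / 2 + |t| + ∫ y, |y| ∂μ) =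
        ∫ y, 2 * (n : ℝ) ^ (-(1 / 2) : ℝ) * (1 / 2 + |t| + |y|) ∂μ := by
      rw [integral_const_mul, integral_add (integrable_const _) hab]
      simp [μ]
    rw [this]
    refine norm_integral_le_of_norm_le (((integrable_const _).add hab).const_mul _) ?_
    exact Eventually.of_forall fun y => by rw [norm_mul, hen, one_mul]; exact hrn y

/-- Pointwise bound of the smoothed sum by `ζ` on the critical line. -/
theorem exists_norm_smoothSum_le {K : ℝ} (hK : 0 < K) :
    ∃ ε : ℕ → ℝ, Tendsto ε atTop (𝓝 0) ∧ (∀ n, 0 ≤ ε n) ∧ ∀ n : ℕ, 1 ≤ n → ∀ t : ℝ,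
      ‖smoothSum K n t‖ ≤ Real.sqrt (2 * Real.pi) * Real.exp (1 / 8) * K * Real.exp (-t ^ 2 / 2) +
        Real.sqrt K * ∫ y, ‖riemannZeta (critPt (t + y))‖ ∂(gaussianReal 0 1) +
        ε n * (1 + |t|) := by
  set A := ∫ y, |y| ∂(gaussianReal 0 1) with hA
  have hA0 : 0 ≤ A := integral_nonneg fun y => abs_nonneg y
  set g : ℝ → ℝ := fun u => ‖mainIntegrand (Real.log K) 0 u‖ with hg
  have hgi : Integrable g := (integrable_mainIntegrand _ _).norm
  have hgt : ∀ t u, ‖mainIntegrand (Real.log K) t u‖ = g u := fun t u => by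
    simp only [hg, norm_mainIntegrand]
  -- The error collects the Gaussian tail beyond log n, uniform in t because the modulus of the
  -- integrand does not depend on t, and the truncation remainder. Both vanish as n → ∞ for fixed K.
  refine ⟨fun n => Real.sqrt K * ((∫ u in Set.Ioi (Real.log n), g u) +
    2 * (n : ℝ) ^ (-(1 / 2) : ℝ) * (1 + A)), ?_, ?_, ?_⟩
  · have hlog : Tendsto (fun n : ℕ => Real.log n) atTop atTop :=
      Real.tendsto_log_atTop.comp tendsto_natCast_atTop_atTop
    have h1 : Tendsto (fun n : ℕ => ∫ u in Set.Iic (Real.log n), g u) atTop (𝓝 (∫ u, g u)) :=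
      (aecover_Iic hlog).integral_tendsto_of_countably_generated hgi
    have h2 : Tendsto (fun n : ℕ => ∫ u in Set.Ioi (Real.log n), g u) atTop (𝓝 0) := by
      have : ∀ n : ℕ, ∫ u in Set.Ioi (Real.log n), g u =
          (∫ u, g u) - ∫ u in Set.Iic (Real.log n), g u := fun n => by
        rw [← integral_add_compl (measurableSet_Iic (a := Real.log n)) hgi, Set.compl_Iic]
        ring
      simp_rw [this]
      simpa using h1.const_sub (∫ u, g u)
    have h3 : Tendsto (fun n : ℕ => (n : ℝ) ^ (-(1 / 2) : ℝ)) atTop (𝓝 0) :=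
      (tendsto_rpow_neg_atTop (by norm_num : (0 : ℝ) < 1 / 2)).comp tendsto_natCast_atTop_atTop
    simpa using (h2.add ((h3.const_mul 2).mul_const (1 + A))).const_mul (Real.sqrt K)
  · intro n
    have : 0 ≤ ∫ u in Set.Ioi (Real.log n), g u := integral_nonneg fun u => norm_nonneg _
    positivity
  · intro n hn t
    refine (norm_smoothSum_le K hn t).trans ?_
    have hm : ‖∫ u in Set.Iic (Real.log n), mainIntegrand (Real.log K) t u‖ ≤
        Real.sqrt (2 * Real.pi) * Real.exp (1 / 8) * Real.sqrt K * Real.exp (-t ^ 2 / 2) +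
          ∫ u in Set.Ioi (Real.log n), g u := by
      rw [← norm_integral_mainIntegrand hK t]
      have hadd := integral_add_compl (measurableSet_Iic (a := Real.log n))
        (integrable_mainIntegrand (Real.log K) t)
      rw [Set.compl_Iic] at hadd
      have hle : ‖∫ u in Set.Ioi (Real.log n), mainIntegrand (Real.log K) t u‖ ≤
          ∫ u in Set.Ioi (Real.log n), g u := by
        refine (norm_integral_le_integral_norm _).trans (le_of_eq ?_)
        simp_rw [hgt]
      have := norm_sub_le (∫ u, mainIntegrand (Real.log K) t u)
        (∫ u in Set.Ioi (Real.log n), mainIntegrand (Real.log K) t u)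
      rw [← hadd, add_sub_cancel_right] at this
      rw [← hadd]
      linarith
    have hK2 : Real.sqrt K * Real.sqrt K = K := Real.mul_self_sqrt hK.le
    set S := ∫ u in Set.Ioi (Real.log n), g u
    have hS : 0 ≤ S := integral_nonneg fun u => norm_nonneg _
    set p := (n : ℝ) ^ (-(1 / 2) : ℝ)
    have hp : 0 ≤ p := by positivity
    have ht := abs_nonneg t
    have hs := Real.sqrt_nonneg K
    have h1 : 2 * p * (1 / 2 + |t| + A) ≤ 2 * p * (1 + A) * (1 + |t|) := by
      have : 0 ≤ p * (1 / 2 + A * |t|) := by positivity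
      nlinarith
    have h2 : S ≤ S * (1 + |t|) := by nlinarith [mul_nonneg hS ht]
    have h3 := mul_le_mul_of_nonneg_left (add_le_add (add_le_add_left hm
      (∫ y, ‖riemannZeta (critPt (t + y))‖ ∂(gaussianReal 0 1))) h1) hs
    refine h3.trans ?_
    have h4 := mul_le_mul_of_nonneg_left h2 hs
    set Z := ∫ y, ‖riemannZeta (critPt (t + y))‖ ∂(gaussianReal 0 1)
    set c := Real.sqrt (2 * Real.pi) * Real.exp (1 / 8)
    set E := Real.exp (-t ^ 2 / 2)
    have h5 : c * K * E = Real.sqrt K * (c * Real.sqrt K * E) := by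
      linear_combination -(c * E) * hK2
    rw [h5]
    linarith

/-! ### Mean squares of exponential sums and the quadratic form in logarithmic frequencies -/

theorem integral_norm_sq_exp_sum_gaussianReal {ι : Type*} (s : Finset ι) (a θ : ι → ℝ)
    (v : NNReal) :
    ∫ t, ‖∑ i ∈ s, (a i : ℂ) * Complex.exp (-(t * θ i : ℝ) * Complex.I)‖ ^ 2 ∂(gaussianReal 0 v) =
      ∑ i ∈ s, ∑ j ∈ s, a i * a j * Real.exp (-(v * (θ i - θ j) ^ 2) / 2) := by
  have hpt : ∀ t : ℝ, ((‖∑ i ∈ s, (a i : ℂ) *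
      Complex.exp (-(t * θ i : ℝ) * Complex.I)‖ ^ 2 : ℝ) : ℂ) =
      ∑ i ∈ s, ∑ j ∈ s, ((a i * a j : ℝ) : ℂ) *
        Complex.exp ((θ j - θ i : ℝ) * t * Complex.I) := by
    intro t
    rw [Complex.ofReal_pow, ← Complex.mul_conj', map_sum, Finset.sum_mul_sum]
    refine Finset.sum_congr rfl fun i _ => Finset.sum_congr rfl fun j _ => ?_
    rw [map_mul, Complex.conj_ofReal, ← Complex.exp_conj, mul_mul_mul_comm, ← Complex.exp_add,
      ← Complex.ofReal_mul]
    congr 2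
    rw [map_mul, map_neg, Complex.conj_ofReal, Complex.conj_I]
    push_cast
    ring
  have hi : ∀ i j, Integrable (fun t : ℝ => ((a i * a j : ℝ) : ℂ) *
      Complex.exp ((θ j - θ i : ℝ) * t * Complex.I)) (gaussianReal 0 v) := fun i j => by
    refine integrable_of_norm_le_linear (Continuous.aestronglyMeasurable (by fun_prop))
      |a i * a j| 0 fun t => ?_
    rw [norm_mul, ← Complex.ofReal_mul, Complex.norm_exp_ofReal_mul_I, Complex.norm_real]
    simp
  have h : ((∫ t, ‖∑ i ∈ s, (a i : ℂ) *
      Complex.exp (-(t * θ i : ℝ) * Complex.I)‖ ^ 2 ∂(gaussianReal 0 v) : ℝ) : ℂ) =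
      ((∑ i ∈ s, ∑ j ∈ s, a i * a j * Real.exp (-(v * (θ i - θ j) ^ 2) / 2) : ℝ) : ℂ) := by
    rw [← integral_complex_ofReal]
    simp_rw [hpt]
    rw [integral_finsetSum _ fun i _ => integrable_finsetSum _ fun j _ => hi i j,
      Complex.ofReal_sum]
    refine Finset.sum_congr rfl fun i _ => ?_
    rw [integral_finsetSum _ fun j _ => hi i j, Complex.ofReal_sum]
    refine Finset.sum_congr rfl fun j _ => ?_
    rw [integral_const_mul, integral_cexp_mul_I_gaussianReal, ← Complex.ofReal_mul,
      ← neg_sub, neg_sq]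
  exact_mod_cast h

theorem norm_exp_sum_le {ι : Type*} (s : Finset ι) {a : ι → ℝ} (ha : ∀ i ∈ s, 0 ≤ a i)
    (θ : ι → ℝ) (t : ℝ) :
    ‖∑ i ∈ s, (a i : ℂ) * Complex.exp (-(t * θ i : ℝ) * Complex.I)‖ ≤ ∑ i ∈ s, a i := by
  refine (norm_sum_le _ _).trans (Finset.sum_le_sum fun i hi => ?_)
  rw [norm_mul, ← Complex.ofReal_neg, Complex.norm_exp_ofReal_mul_I, Complex.norm_real,
    Real.norm_of_nonneg (ha i hi), mul_one]

theorem logWeight_nonneg (K : ℝ) (j : ℕ) : 0 ≤ logWeight K j := by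
  unfold logWeight; positivity

/-- With l = log(j/K) in [0, log 2] the weight is exp(-(l + l²)/2), and (l + l²)/2 ≤ l ≤ log 2
because l ≤ 1. -/
theorem half_le_logWeight {K j : ℕ} (hK : 1 ≤ K) (hj : j ∈ Finset.Ico K (2 * K)) :
    1 / 2 ≤ logWeight K j := by
  obtain ⟨h1, h2⟩ := Finset.mem_Ico.1 hj
  have hK0 : (0 : ℝ) < K := by exact_mod_cast hK
  have hj0 : (0 : ℝ) < j := by exact_mod_cast (by omega : 0 < j)
  have h1' : (K : ℝ) ≤ j := by exact_mod_cast h1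
  have h2' : (j : ℝ) ≤ 2 * K := by exact_mod_cast h2.le
  set l := Real.log j - Real.log K with hl
  have hl0 : 0 ≤ l := sub_nonneg.2 (Real.log_le_log hK0 h1')
  have hl1 : l ≤ Real.log 2 := by
    have := Real.log_le_log hj0 h2'
    rw [Real.log_mul (by norm_num) hK0.ne'] at this
    linarith
  have hlog2 := Real.log_two_lt_d9
  have hw : logWeight K j = Real.exp (-(l / 2 + l ^ 2 / 2)) := by
    rw [logWeight, Real.sqrt_eq_rpow, Real.rpow_def_of_pos hK0, Real.rpow_def_of_pos hj0,
      ← Real.exp_add, ← Real.exp_add]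
    congr 1
    rw [hl]
    ring
  rw [hw, ← Real.exp_log (show (0 : ℝ) < 1 / 2 by norm_num), Real.exp_le_exp, one_div,
    Real.log_inv]
  nlinarith

/-- The `κ`-th moment of `ζ` on the critical line in a Gaussian window of width `T`. -/
noncomputable def gaussianMoment (κ T : ℝ) : ℝ :=
  ∫ u, ‖riemannZeta (critPt u)‖ ^ κ ∂(gaussianReal 0 ((T ^ 2).toNNReal + 1))

theorem integrable_zeta_rpow_gaussianReal {κ : ℝ} (hκ : 0 < κ) (v : NNReal) :
    Integrable (fun u => ‖riemannZeta (critPt u)‖ ^ κ) (gaussianReal 0 v) := by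
  have h0 : MemLp (fun u : ℝ => |u|) (ENNReal.ofReal κ) (gaussianReal 0 v) :=
    (memLp_id_gaussianReal' (ENNReal.ofReal κ) ENNReal.ofReal_ne_top).norm
  have h1 : MemLp (fun _ : ℝ => (4 : ℝ)) (ENNReal.ofReal κ) (gaussianReal 0 v) := memLp_const 4
  have h : MemLp (fun u : ℝ => 4 + 2 * |u|) (ENNReal.ofReal κ) (gaussianReal 0 v) :=
    h1.add (h0.const_mul 2)
  have h2 := h.integrable_norm_rpow (by simpa using hκ) ENNReal.ofReal_ne_top
  simp only [ENNReal.toReal_ofReal hκ.le] at h2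
  refine h2.mono' (Continuous.aestronglyMeasurable ?_) (Eventually.of_forall fun u => ?_)
  · exact continuous_zeta_critPt.norm.rpow_const fun _ => Or.inr hκ.le
  · rw [Real.norm_of_nonneg (by positivity)]
    refine Real.rpow_le_rpow (norm_nonneg _) ?_ hκ.le
    rw [Real.norm_of_nonneg (by positivity)]
    exact norm_zeta_critPt_le u

/-- Averaging the unit-variance smoothing over a window of variance T² is a convolution of
Gaussians; variances add, whence the T² + 1 in `gaussianMoment`. -/
theorem integrable_conv_zeta {κ T : ℝ} (hκ : 0 < κ) :
    Integrable (fun t => ∫ y, ‖riemannZeta (critPt (t + y))‖ ^ κ ∂(gaussianReal 0 1))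
      (gaussianReal 0 (T ^ 2).toNNReal) ∧
    ∫ t, ∫ y, ‖riemannZeta (critPt (t + y))‖ ^ κ ∂(gaussianReal 0 1)
      ∂(gaussianReal 0 (T ^ 2).toNNReal) = gaussianMoment κ T := by
  have hi := integrable_zeta_rpow_gaussianReal hκ ((T ^ 2).toNNReal + 1)
  have hc := gaussianReal_conv_gaussianReal (m₁ := 0) (m₂ := 0) (v₁ := (T ^ 2).toNNReal) (v₂ := 1)
  rw [add_zero] at hc
  have hm : AEStronglyMeasurable (fun u => ‖riemannZeta (critPt u)‖ ^ κ)
      ((gaussianReal 0 (T ^ 2).toNNReal) ∗ (gaussianReal 0 1)) := hc ▸ hi.aestronglyMeasurable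
  rw [← hc] at hi
  refine ⟨((integrable_conv_iff hm).1 hi).2.congr ?_, ?_⟩
  · refine Eventually.of_forall fun t => integral_congr_ae (Eventually.of_forall fun y => ?_)
    simp [abs_of_nonneg, Real.rpow_nonneg]
  · rw [gaussianMoment, ← hc, integral_conv hi]

theorem sq_integral_le_integral_sq {μ : Measure ℝ} [IsProbabilityMeasure μ] {f : ℝ → ℝ}
    (hf : Integrable f μ) (hf2 : Integrable (fun x => f x ^ 2) μ) :
    (∫ x, f x ∂μ) ^ 2 ≤ ∫ x, f x ^ 2 ∂μ := by
  set m := ∫ x, f x ∂μ with hm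
  have h0 : 0 ≤ ∫ x, (f x - m) ^ 2 ∂μ := integral_nonneg fun x => sq_nonneg _
  have h1 : ∀ x, (f x - m) ^ 2 = f x ^ 2 - 2 * m * f x + m ^ 2 := fun x => by ring
  simp_rw [h1] at h0
  have h2 : Integrable (fun x => f x ^ 2 - 2 * m * f x) μ := hf2.sub (hf.const_mul _)
  rw [integral_add h2 (integrable_const _), integral_sub hf2 (hf.const_mul _),
    integral_const_mul, ← hm] at h0
  simp at h0
  nlinarith

/-- Separates small from large values: if z² > L then z^κ = z² (z²)^(κ/2-1) exceeds z² L^(κ/2-1).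
The level L stays free, to be optimised later. -/
theorem sq_le_add_rpow {z L κ : ℝ} (hz : 0 ≤ z) (hL : 0 < L) (hκ : 2 ≤ κ) :
    z ^ 2 ≤ L + L ^ (1 - κ / 2) * z ^ κ := by
  by_cases h : z ^ 2 ≤ L
  · have : 0 ≤ L ^ (1 - κ / 2) * z ^ κ := by positivity
    linarith
  · push Not at h
    have hz0 : 0 < z := by
      rcases hz.eq_or_lt with rfl | h0
      · norm_num at h; linarith
      · exact h0
    have h1 : z ^ κ = z ^ 2 * (z ^ 2) ^ (κ / 2 - 1) := by
      rw [← Real.rpow_natCast, ← Real.rpow_mul hz, ← Real.rpow_add hz0]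
      congr 1
      push_cast
      ring
    have h2 : 1 ≤ L ^ (1 - κ / 2) * (z ^ 2) ^ (κ / 2 - 1) := by
      rw [← neg_sub, Real.rpow_neg hL.le, inv_mul_eq_div, one_le_div (by positivity)]
      exact Real.rpow_le_rpow hL.le h.le (by linarith)
    rw [h1]
    nlinarith [sq_nonneg z]

/-- The Gaussian density of variance T² is at most 1/(T√(2π)), so bounded t carry mass O(1/T). -/
theorem integral_exp_neg_sq_gaussianReal_le {T : ℝ} (hT : 0 < T) :
    ∫ t, Real.exp (-t ^ 2 / 2) ^ 2 ∂(gaussianReal 0 (T ^ 2).toNNReal) ≤ 1 / T := by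
  have hv : (T ^ 2).toNNReal ≠ 0 := by simp [hT.ne']
  rw [integral_gaussianReal_eq_integral_smul hv]
  have hle : ∀ t : ℝ, gaussianPDFReal 0 (T ^ 2).toNNReal t • Real.exp (-t ^ 2 / 2) ^ 2 ≤
      (√(2 * Real.pi * T ^ 2))⁻¹ * Real.exp (-1 * t ^ 2) := by
    intro t
    rw [gaussianPDFReal, smul_eq_mul, Real.coe_toNNReal _ (sq_nonneg T), mul_assoc]
    refine mul_le_mul_of_nonneg_left ?_ (by positivity)
    rw [← Real.exp_nat_mul]
    have : Real.exp (-(t - 0) ^ 2 / (2 * T ^ 2)) ≤ 1 := by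
      rw [Real.exp_le_one_iff, neg_div]
      exact neg_nonpos.2 (by positivity)
    refine (mul_le_of_le_one_left (Real.exp_nonneg _) this).trans (le_of_eq ?_)
    congr 1
    push_cast
    ring
  refine (integral_mono_of_nonneg (Eventually.of_forall fun t => ?_)
    ((integrable_exp_neg_mul_sq one_pos).const_mul _) (Eventually.of_forall hle)).trans ?_
  · exact smul_nonneg (gaussianPDFReal_nonneg _ _ _) (by positivity)
  · rw [integral_const_mul, integral_gaussian, Real.sqrt_mul (by positivity),
      Real.sqrt_sq hT.le, mul_inv, div_one, mul_right_comm, ← one_div T]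
    refine mul_le_of_le_one_left (by positivity) ?_
    rw [inv_mul_eq_div, div_le_one (by positivity)]
    exact Real.sqrt_le_sqrt (by linarith [Real.pi_pos])

theorem summable_exp_neg_int_sq : Summable fun d : ℤ => Real.exp (-(d : ℝ) ^ 2 / 2) := by
  have h := summable_pow_mul_jacobiTheta₂_term_bound 0
    (show (0 : ℝ) < 1 / (2 * Real.pi) by positivity) 0
  refine h.congr fun d => ?_
  rw [pow_zero, one_mul]
  congr 1
  have := Real.pi_ne_zero
  field_simp
  ring

/-- Schur's bound for the Gaussian kernel on the integers. -/
theorem sum_sum_gaussian_le (S : Finset ℤ) (v : ℤ → ℝ) :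
    ∑ k ∈ S, ∑ l ∈ S, v k * v l * Real.exp (-((k : ℝ) - l) ^ 2 / 2) ≤
      (∑' d : ℤ, Real.exp (-(d : ℝ) ^ 2 / 2)) * ∑ k ∈ S, v k ^ 2 := by
  set g : ℤ → ℝ := fun d => Real.exp (-(d : ℝ) ^ 2 / 2) with hg
  have hsym : ∀ d, g (-d) = g d := fun d => by simp [hg]
  have hrow : ∀ k, ∑ l ∈ S, g (k - l) ≤ ∑' d, g d := fun k => by
    have hinj : Function.Injective fun l : ℤ => k - l := fun a b h => by simpa using h
    rw [← Finset.sum_image (f := g) (g := fun l => k - l) (s := S) fun a _ b _ h => hinj h]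
    exact summable_exp_neg_int_sq.sum_le_tsum _ fun d _ => Real.exp_nonneg _
  have hterm : ∀ k l : ℤ, v k * v l * Real.exp (-((k : ℝ) - l) ^ 2 / 2) ≤
      1 / 2 * (v k ^ 2 * g (k - l)) + 1 / 2 * (v l ^ 2 * g (l - k)) := fun k l => by
    rw [← hsym (l - k), neg_sub]
    have : g (k - l) = Real.exp (-((k : ℝ) - l) ^ 2 / 2) := by simp [hg]
    rw [← this]
    have : 0 ≤ g (k - l) := Real.exp_nonneg _
    nlinarith [mul_nonneg this (sq_nonneg (v k - v l))]
  have hone : ∑ k ∈ S, ∑ l ∈ S, v k ^ 2 * g (k - l) ≤ (∑' d, g d) * ∑ k ∈ S, v k ^ 2 := by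
    rw [Finset.mul_sum]
    refine Finset.sum_le_sum fun k _ => ?_
    rw [← Finset.mul_sum, mul_comm]
    exact mul_le_mul_of_nonneg_right (hrow k) (sq_nonneg _)
  refine (Finset.sum_le_sum fun k _ => Finset.sum_le_sum fun l _ => hterm k l).trans ?_
  have hcomm : ∑ k ∈ S, ∑ l ∈ S, v l ^ 2 * g (l - k) = ∑ k ∈ S, ∑ l ∈ S, v k ^ 2 * g (k - l) :=
    Finset.sum_comm
  simp_rw [Finset.sum_add_distrib, ← Finset.mul_sum] at hone hcomm ⊢
  rw [hcomm]
  linarith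

/-- The Gaussian quadratic form in the frequencies `log j + k / T`, with `K ≤ j < 2K`. -/
noncomputable def logForm (T : ℝ) (K : ℕ) (S : Finset ℤ) (v : ℤ → ℝ) : ℝ :=
  ∑ p ∈ Finset.Ico K (2 * K) ×ˢ S, ∑ q ∈ Finset.Ico K (2 * K) ×ˢ S,
    v p.2 * v q.2 * Real.exp (-(T * (Real.log p.1 - Real.log q.1) + (p.2 - q.2)) ^ 2 / 2)

/-- The exponential sum `∑ k ∈ S, v k * exp (-i t k / T)`. -/
noncomputable def windowSum (T : ℝ) (S : Finset ℤ) (v : ℤ → ℝ) (t : ℝ) : ℂ :=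
  ∑ k ∈ S, (v k : ℂ) * Complex.exp (-(t * (k / T) : ℝ) * Complex.I)

theorem continuous_windowSum (T : ℝ) (S : Finset ℤ) (v : ℤ → ℝ) :
    Continuous (windowSum T S v) := by unfold windowSum; fun_prop

theorem norm_windowSum_le (T : ℝ) (S : Finset ℤ) {v : ℤ → ℝ} (hv : ∀ k, 0 ≤ v k) (t : ℝ) :
    ‖windowSum T S v t‖ ≤ ∑ k ∈ S, v k :=
  norm_exp_sum_le S (fun k _ => hv k) _ t

theorem integral_windowSum_sq_le {T : ℝ} (hT : 0 < T) (S : Finset ℤ) (v : ℤ → ℝ) :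
    ∫ t, ‖windowSum T S v t‖ ^ 2 ∂(gaussianReal 0 (T ^ 2).toNNReal) ≤
      (∑' d : ℤ, Real.exp (-(d : ℝ) ^ 2 / 2)) * ∑ k ∈ S, v k ^ 2 := by
  have h := integral_norm_sq_exp_sum_gaussianReal S v (fun k => (k : ℝ) / T) (T ^ 2).toNNReal
  simp only [windowSum]
  rw [h]
  refine le_trans (le_of_eq ?_) (sum_sum_gaussian_le S v)
  refine Finset.sum_congr rfl fun k _ => Finset.sum_congr rfl fun l _ => ?_
  rw [Real.coe_toNNReal _ (sq_nonneg T)]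
  congr 3
  field_simp

/-- Opening the square gives a double sum of nonnegative terms, so discarding all j outside [K, 2K)
only decreases it. On that range each of the two weights is at least 1/2, hence the factor 4. -/
theorem logForm_le_integral {T : ℝ} (hT : 0 < T) {K n : ℕ} (hK : 1 ≤ K) (hn : 2 * K ≤ n)
    (S : Finset ℤ) {v : ℤ → ℝ} (hv : ∀ k, 0 ≤ v k) :
    logForm T K S v ≤ 4 * ∫ t, ‖smoothSum K n t‖ ^ 2 * ‖windowSum T S v t‖ ^ 2
      ∂(gaussianReal 0 (T ^ 2).toNNReal) := by
  have hprod : ∀ t, ‖smoothSum K n t‖ ^ 2 * ‖windowSum T S v t‖ ^ 2 =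
      ‖∑ p ∈ Finset.Icc 1 n ×ˢ S, ((logWeight K p.1 * v p.2 : ℝ) : ℂ) *
        Complex.exp (-(t * (Real.log p.1 + p.2 / T) : ℝ) * Complex.I)‖ ^ 2 := by
    intro t
    rw [← mul_pow, ← norm_mul, smoothSum, windowSum, Finset.sum_mul_sum, Finset.sum_product]
    congr 2
    refine Finset.sum_congr rfl fun j _ => Finset.sum_congr rfl fun k _ => ?_
    rw [mul_mul_mul_comm, ← Complex.exp_add, ← Complex.ofReal_mul]
    congr 2
    simp only [Complex.ofReal_mul, Complex.ofReal_add]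
    ring
  simp_rw [hprod]
  rw [integral_norm_sq_exp_sum_gaussianReal (Finset.Icc 1 n ×ˢ S)
    (fun p : ℕ × ℤ => logWeight K p.1 * v p.2) (fun p => Real.log p.1 + p.2 / T), logForm]
  have hsub : Finset.Ico K (2 * K) ×ˢ S ⊆ Finset.Icc 1 n ×ˢ S := by
    refine Finset.product_subset_product_left fun j hj => ?_
    rw [Finset.mem_Ico] at hj
    rw [Finset.mem_Icc]
    omega
  have hnn : ∀ p q : ℕ × ℤ, 0 ≤ logWeight K p.1 * v p.2 * (logWeight K q.1 * v q.2) *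
      Real.exp (-((T ^ 2).toNNReal * (Real.log p.1 + p.2 / T - (Real.log q.1 + q.2 / T)) ^ 2) / 2) :=
    fun p q => mul_nonneg (mul_nonneg (mul_nonneg (logWeight_nonneg _ _) (hv _))
      (mul_nonneg (logWeight_nonneg _ _) (hv _))) (Real.exp_nonneg _)
  have h1 := Finset.sum_le_sum_of_subset_of_nonneg hsub
    fun p _ _ => Finset.sum_nonneg fun q (_ : q ∈ Finset.Icc 1 n ×ˢ S) => hnn p q
  have h2 := Finset.sum_le_sum fun p (_ : p ∈ Finset.Ico K (2 * K) ×ˢ S) =>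
    Finset.sum_le_sum_of_subset_of_nonneg hsub fun q _ _ => hnn p q
  refine le_trans ?_ (mul_le_mul_of_nonneg_left (h2.trans h1) (by norm_num))
  rw [Finset.mul_sum]
  refine Finset.sum_le_sum fun p hp => ?_
  rw [Finset.mul_sum]
  refine Finset.sum_le_sum fun q hq => ?_
  have hp2 := half_le_logWeight hK (Finset.mem_product.1 hp).1
  have hq2 := half_le_logWeight hK (Finset.mem_product.1 hq).1
  have hexp : -((T ^ 2).toNNReal * (Real.log p.1 + p.2 / T - (Real.log q.1 + q.2 / T)) ^ 2) / 2 =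
      -(T * (Real.log p.1 - Real.log q.1) + (p.2 - q.2)) ^ 2 / 2 := by
    rw [Real.coe_toNNReal _ (sq_nonneg T)]
    field_simp
    ring
  rw [hexp, ← mul_assoc]
  refine mul_le_mul_of_nonneg_right ?_ (Real.exp_nonneg _)
  have hvv := mul_nonneg (hv p.2) (hv q.2)
  have hww : 1 / 4 ≤ logWeight K p.1 * logWeight K q.1 := by nlinarith
  nlinarith

theorem add_add_sq_le (a b c : ℝ) : (a + b + c) ^ 2 ≤ 3 * (a ^ 2 + b ^ 2 + c ^ 2) := by
  nlinarith [sq_nonneg (a - b), sq_nonneg (b - c), sq_nonneg (a - c)]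

theorem sq_integral_zeta_le {κ L : ℝ} (hκ : 2 ≤ κ) (hL : 0 < L) (t : ℝ) :
    (∫ y, ‖riemannZeta (critPt (t + y))‖ ∂(gaussianReal 0 1)) ^ 2 ≤
      L + L ^ (1 - κ / 2) * ∫ y, ‖riemannZeta (critPt (t + y))‖ ^ κ ∂(gaussianReal 0 1) := by
  have hκ0 : 0 < κ := by linarith
  have hi : ∀ k : ℝ, 0 < k → Integrable (fun y => ‖riemannZeta (critPt (t + y))‖ ^ k)
      (gaussianReal 0 1) := by
    intro k hk
    have h : MemLp (fun u : ℝ => 4 + 2 * |t| + 2 * |u|) (ENNReal.ofReal k) (gaussianReal 0 1) := by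
      have h0 : MemLp (fun u : ℝ => |u|) (ENNReal.ofReal k) (gaussianReal 0 1) :=
        (memLp_id_gaussianReal' (ENNReal.ofReal k) ENNReal.ofReal_ne_top).norm
      have h1 : MemLp (fun _ : ℝ => 4 + 2 * |t|) (ENNReal.ofReal k) (gaussianReal 0 1) :=
        memLp_const _
      exact h1.add (h0.const_mul 2)
    have h2 := h.integrable_norm_rpow (by simpa using hk) ENNReal.ofReal_ne_top
    simp only [ENNReal.toReal_ofReal hk.le] at h2
    refine h2.mono' (Continuous.aestronglyMeasurable ?_) (Eventually.of_forall fun u => ?_)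
    · exact (continuous_zeta_critPt.comp (by fun_prop : Continuous fun y : ℝ => t + y)).norm.rpow_const
        fun _ => Or.inr hk.le
    · rw [Real.norm_of_nonneg (by positivity)]
      refine Real.rpow_le_rpow (norm_nonneg _) ?_ hk.le
      rw [Real.norm_of_nonneg (by positivity)]
      linarith [norm_zeta_critPt_le (t + u), abs_add_le t u]
  have h1 := hi 1 one_pos
  have h2 := hi 2 two_pos
  simp only [Real.rpow_one, Real.rpow_two] at h1 h2
  refine (sq_integral_le_integral_sq h1 h2).trans ?_
  have h3 : ∫ y, ‖riemannZeta (critPt (t + y))‖ ^ 2 ∂(gaussianReal 0 1) ≤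
      ∫ y, (L + L ^ (1 - κ / 2) * ‖riemannZeta (critPt (t + y))‖ ^ κ) ∂(gaussianReal 0 1) :=
    integral_mono h2 ((integrable_const _).add ((hi κ hκ0).const_mul _))
      fun y => sq_le_add_rpow (norm_nonneg _) hL hκ
  rw [integral_add (integrable_const _) ((hi κ hκ0).const_mul _), integral_const_mul] at h3
  simpa using h3

/-- The three terms come from the pole (mass O(1/T), window sum bounded by ∑ v_k), from ζ below the
level L (mean square of the window sum), and from ζ above it (κ-th moment, window sum again bounded
trivially). The truncation error disappears on letting n → ∞, as the left side does not involve n.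
-/
theorem exists_logForm_le : ∃ C : ℝ, 0 < C ∧ ∀ (κ T L : ℝ) (K : ℕ) (S : Finset ℤ) (v : ℤ → ℝ),
    2 ≤ κ → 0 < T → 0 < L → 1 ≤ K → (∀ k, 0 ≤ v k) →
    logForm T K S v ≤ C * ((K : ℝ) ^ 2 * (∑ k ∈ S, v k) ^ 2 / T + K * (L * ∑ k ∈ S, v k ^ 2) +
      K * (L ^ (1 - κ / 2) * ((∑ k ∈ S, v k) ^ 2 * gaussianMoment κ T))) := by
  set c := Real.sqrt (2 * Real.pi) * Real.exp (1 / 8) with hc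
  set c1 := ∑' d : ℤ, Real.exp (-(d : ℝ) ^ 2 / 2) with hc1
  have hc10 : 0 ≤ c1 := tsum_nonneg fun d => Real.exp_nonneg _
  refine ⟨12 * (c ^ 2 + c1 + 1), by positivity, fun κ T L K S v hκ hT hL hK hv => ?_⟩
  have hκ0 : 0 < κ := by linarith
  have hK0 : (0 : ℝ) < K := by exact_mod_cast hK
  set ν := gaussianReal 0 (T ^ 2).toNNReal with hν
  set V := ∑ k ∈ S, v k with hV
  set W := ∑ k ∈ S, v k ^ 2 with hW
  set M := gaussianMoment κ T with hM
  have hV0 : 0 ≤ V := Finset.sum_nonneg fun k _ => hv k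
  have hW0 : 0 ≤ W := Finset.sum_nonneg fun k _ => sq_nonneg _
  have hM0 : 0 ≤ M := integral_nonneg fun u => by positivity
  set Q : ℝ → ℝ := fun t => ‖windowSum T S v t‖ ^ 2 with hQ
  have hQ0 : ∀ t, 0 ≤ Q t := fun t => sq_nonneg _
  have hQV : ∀ t, Q t ≤ V ^ 2 := fun t =>
    pow_le_pow_left₀ (norm_nonneg _) (norm_windowSum_le T S hv t) 2
  have hQc : Continuous Q := (continuous_windowSum T S v).norm.pow 2
  set F : ℝ → ℝ := fun t => ∫ y, ‖riemannZeta (critPt (t + y))‖ ^ κ ∂(gaussianReal 0 1) with hF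
  have hF0 : ∀ t, 0 ≤ F t := fun t => integral_nonneg fun y => by positivity
  obtain ⟨hFi, hFM⟩ := integrable_conv_zeta (T := T) hκ0
  obtain ⟨ε, hε, hε0, hb⟩ := exists_norm_smoothSum_le hK0
  have hsq : Integrable (fun t : ℝ => (1 + |t|) ^ 2) ν := by
    have h0 : MemLp (fun u : ℝ => |u|) 2 ν := (memLp_id_gaussianReal' 2 (by simp)).norm
    exact ((memLp_const (1 : ℝ)).add h0).integrable_sq
  set G := ∫ t, (1 + |t|) ^ 2 ∂ν with hG
  set r := L ^ (1 - κ / 2) with hr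
  have hr0 : 0 ≤ r := by positivity
  have hE1 : Integrable (fun t : ℝ => Real.exp (-t ^ 2 / 2) ^ 2) ν := by
    refine integrable_of_norm_le_linear (Continuous.aestronglyMeasurable (by fun_prop)) 1 0
      fun t => ?_
    rw [Real.norm_of_nonneg (by positivity), zero_mul, add_zero]
    exact pow_le_one₀ (Real.exp_nonneg _) (Real.exp_le_one_iff.2 (by nlinarith [sq_nonneg t]))
  have hQi : Integrable Q ν := by
    refine integrable_of_norm_le_linear hQc.aestronglyMeasurable (V ^ 2) 0 fun t => ?_
    rw [Real.norm_of_nonneg (hQ0 t), zero_mul, add_zero]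
    exact hQV t
  have hbound : ∀ n : ℕ, 2 * K ≤ n → logForm T K S v ≤
      12 * (c ^ 2 * K ^ 2 * V ^ 2 / T + K * (L * (c1 * W)) + K * (r * (V ^ 2 * M)) +
        ε n ^ 2 * (V ^ 2 * G)) := by
    intro n hn
    refine (logForm_le_integral hT hK hn S hv).trans ?_
    have hpt : ∀ t, ‖smoothSum K n t‖ ^ 2 * ‖windowSum T S v t‖ ^ 2 ≤
        3 * (c ^ 2 * K ^ 2 * V ^ 2) * Real.exp (-t ^ 2 / 2) ^ 2 + 3 * (K * L) * Q t +
          3 * (K * r * V ^ 2) * F t + 3 * (ε n ^ 2 * V ^ 2) * (1 + |t|) ^ 2 := by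
      intro t
      have h1 := pow_le_pow_left₀ (norm_nonneg _) (hb n (by omega) t) 2
      have h2 := h1.trans (add_add_sq_le _ _ _)
      have h3 := sq_integral_zeta_le hκ hL t
      rw [mul_pow (Real.sqrt K), Real.sq_sqrt hK0.le, mul_pow, mul_pow _ (1 + |t|), mul_pow] at h2
      have h4 := mul_le_mul_of_nonneg_right h2 (hQ0 t)
      refine h4.trans ?_
      have h5 : K * (∫ y, ‖riemannZeta (critPt (t + y))‖ ∂(gaussianReal 0 1)) ^ 2 * Q t ≤
          K * L * Q t + K * r * V ^ 2 * F t := by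
        have h6 : K * (∫ y, ‖riemannZeta (critPt (t + y))‖ ∂(gaussianReal 0 1)) ^ 2 * Q t ≤
          K * (L + r * F t) * Q t :=
          mul_le_mul_of_nonneg_right (mul_le_mul_of_nonneg_left h3 hK0.le) (hQ0 t)
        have h7 : K * r * F t * Q t ≤ K * r * F t * V ^ 2 :=
          mul_le_mul_of_nonneg_left (hQV t) (mul_nonneg (mul_nonneg hK0.le hr0) (hF0 t))
        linarith
      have h8 : c ^ 2 * K ^ 2 * Real.exp (-t ^ 2 / 2) ^ 2 * Q t ≤
          c ^ 2 * K ^ 2 * Real.exp (-t ^ 2 / 2) ^ 2 * V ^ 2 :=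
        mul_le_mul_of_nonneg_left (hQV t) (by positivity)
      have h9 : ε n ^ 2 * (1 + |t|) ^ 2 * Q t ≤ ε n ^ 2 * (1 + |t|) ^ 2 * V ^ 2 :=
        mul_le_mul_of_nonneg_left (hQV t) (by positivity)
      linarith
    have hi1 := hE1.const_mul (3 * (c ^ 2 * K ^ 2 * V ^ 2))
    have hi2 := hQi.const_mul (3 * (K * L))
    have hi3 := hFi.const_mul (3 * (K * r * V ^ 2))
    have hi4 := hsq.const_mul (3 * (ε n ^ 2 * V ^ 2))
    have hi12 : Integrable (fun t => 3 * (c ^ 2 * K ^ 2 * V ^ 2) * Real.exp (-t ^ 2 / 2) ^ 2 +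
        3 * (K * L) * Q t) ν := hi1.add hi2
    have hi123 : Integrable (fun t => 3 * (c ^ 2 * K ^ 2 * V ^ 2) * Real.exp (-t ^ 2 / 2) ^ 2 +
        3 * (K * L) * Q t + 3 * (K * r * V ^ 2) * F t) ν := hi12.add hi3
    have hmono := integral_mono_of_nonneg (μ := ν)
      (Eventually.of_forall fun t => by positivity) (hi123.add hi4) (Eventually.of_forall hpt)
    simp only [Pi.add_apply] at hmono
    rw [integral_add hi123 hi4, integral_add hi12 hi3, integral_add hi1 hi2, integral_const_mul,
      integral_const_mul, integral_const_mul, integral_const_mul, hFM] at hmono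
    have hA := mul_le_mul_of_nonneg_left (integral_exp_neg_sq_gaussianReal_le hT)
      (show 0 ≤ 3 * (c ^ 2 * K ^ 2 * V ^ 2) by positivity)
    have hB := mul_le_mul_of_nonneg_left (integral_windowSum_sq_le hT S v)
      (show 0 ≤ 3 * (K * L) by positivity)
    have hdiv : c ^ 2 * K ^ 2 * V ^ 2 / T = c ^ 2 * K ^ 2 * V ^ 2 * (1 / T) := by ring
    rw [hdiv]
    linarith
  have hlim : Tendsto (fun n : ℕ => 12 * (c ^ 2 * K ^ 2 * V ^ 2 / T + K * (L * (c1 * W)) +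
      K * (r * (V ^ 2 * M)) + ε n ^ 2 * (V ^ 2 * G))) atTop
      (𝓝 (12 * (c ^ 2 * K ^ 2 * V ^ 2 / T + K * (L * (c1 * W)) + K * (r * (V ^ 2 * M)) +
        0 ^ 2 * (V ^ 2 * G)))) :=
    (((hε.pow 2).mul_const _).const_add _).const_mul _
  have hfin := ge_of_tendsto hlim ((eventually_ge_atTop (2 * K)).mono hbound)
  refine hfin.trans ?_
  have hx : 0 ≤ K ^ 2 * V ^ 2 / T := by positivity
  have hy : 0 ≤ K * (L * W) := by positivity
  have hz : 0 ≤ K * (r * (V ^ 2 * M)) := by positivity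
  have hx' : c ^ 2 * K ^ 2 * V ^ 2 / T = c ^ 2 * (K ^ 2 * V ^ 2 / T) := by ring
  have hy' : K * (L * (c1 * W)) = c1 * (K * (L * W)) := by ring
  rw [hx', hy']
  nlinarith [mul_nonneg (sq_nonneg c) hy, mul_nonneg (sq_nonneg c) hz, mul_nonneg hc10 hx,
    mul_nonneg hc10 hz]

/-! ### From the sharp moment bound to Gaussian windows -/

theorem norm_zeta_critPt_abs (u : ℝ) : ‖riemannZeta (critPt |u|)‖ = ‖riemannZeta (critPt u)‖ := by
  rcases abs_cases u with ⟨h, _⟩ | ⟨h, _⟩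
  · rw [h]
  · have : critPt (-u) = (starRingEnd ℂ) (critPt u) := by
      apply Complex.ext <;> simp
    rw [h, this, riemannZeta_conj, Complex.norm_conj]

theorem summable_exp_neg_sq_mul_rpow (p : ℝ) :
    Summable fun n : ℕ => Real.exp (-(n : ℝ) ^ 2 / 4) * ((n : ℝ) + 1) ^ p := by
  obtain ⟨k, hk⟩ := exists_nat_ge p
  have h := ((summable_nat_add_iff 1).2
    (Real.summable_pow_mul_exp_neg_nat_mul k (show (0 : ℝ) < 1 / 2 by norm_num))).mul_left
      (Real.exp (3 / 4))
  refine h.of_nonneg_of_le (fun n => by positivity) fun n => ?_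
  have h1 : ((n : ℝ) + 1) ^ p ≤ ((n + 1 : ℕ) : ℝ) ^ k := by
    rw [← Real.rpow_natCast]
    push_cast
    exact Real.rpow_le_rpow_of_exponent_le (by linarith [(Nat.cast_nonneg n : (0 : ℝ) ≤ n)]) hk
  have h2 : Real.exp (-(n : ℝ) ^ 2 / 4) ≤
      Real.exp (3 / 4) * Real.exp (-(1 / 2) * ((n + 1 : ℕ) : ℝ)) := by
    rw [← Real.exp_add, Real.exp_le_exp]
    push_cast
    nlinarith [sq_nonneg ((n : ℝ) - 1)]
  calc _ ≤ (Real.exp (3 / 4) * Real.exp (-(1 / 2) * ((n + 1 : ℕ) : ℝ))) *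
        ((n + 1 : ℕ) : ℝ) ^ k := by gcongr
    _ = _ := by ring

theorem gaussianMoment_eq {κ T : ℝ} : gaussianMoment κ T =
    2 * ∫ u in Set.Ioi (0 : ℝ), gaussianPDFReal 0 ((T ^ 2).toNNReal + 1) u *
      ‖riemannZeta (critPt u)‖ ^ κ := by
  rw [gaussianMoment, integral_gaussianReal_eq_integral_smul (by simp), ← integral_comp_abs
    (f := fun u => gaussianPDFReal 0 ((T ^ 2).toNNReal + 1) u * ‖riemannZeta (critPt u)‖ ^ κ)]
  refine integral_congr_ae (Eventually.of_forall fun u => ?_)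
  simp only [norm_zeta_critPt_abs, smul_eq_mul]
  congr 1
  simp [gaussianPDFReal]

theorem gaussianPDFReal_window_le {T u : ℝ} {n : ℕ} (hT : 1 ≤ T) (hu : n * T ≤ u) :
    gaussianPDFReal 0 ((T ^ 2).toNNReal + 1) u ≤ 1 / T * Real.exp (-(n : ℝ) ^ 2 / 4) := by
  have hT0 : 0 < T := by linarith
  rw [gaussianPDFReal, NNReal.coe_add, Real.coe_toNNReal _ (sq_nonneg T), NNReal.coe_one, sub_zero]
  have hT2 : T ^ 2 + 1 ≤ 2 * T ^ 2 := by nlinarith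
  refine mul_le_mul ?_ ?_ (Real.exp_nonneg _) (by positivity)
  · rw [one_div]
    refine inv_anti₀ hT0 ?_
    refine Real.le_sqrt_of_sq_le ?_
    nlinarith [Real.pi_gt_three, sq_nonneg T]
  · rw [Real.exp_le_exp, neg_div, neg_div, neg_le_neg_iff, div_le_div_iff₀ (by norm_num)
      (by positivity)]
    have h1 : ((n : ℝ) * T) ^ 2 ≤ u ^ 2 := pow_le_pow_left₀ (by positivity) hu 2
    nlinarith [mul_nonneg (sq_nonneg (n : ℝ)) (sub_nonneg.2 hT2)]

/-- Cut [0, ∞) into intervals [nT, (n+1)T]. There the density is at most e^(-n²/4)/T, which beats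
the growth (n+1)^(1+m+ε) of the moment; every endpoint (n+1)T is at least T, so the hypothesis
applies uniformly in n. -/
theorem ZetaMomentBound.exists_gaussianMoment_le {κ m : ℝ} (hκ : 0 < κ) (h : ZetaMomentBound κ m)
    {ε : ℝ} (hε : 0 < ε) :
    ∃ C T₀ : ℝ, 0 < C ∧ 1 ≤ T₀ ∧ ∀ T, T₀ ≤ T → gaussianMoment κ T ≤ C * T ^ (m + ε) := by
  obtain ⟨C, hC, hb⟩ := (h ε hε).exists_pos
  obtain ⟨T₁, hT₁⟩ := eventually_atTop.1 hb.bound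
  set A := ∑' n : ℕ, Real.exp (-(n : ℝ) ^ 2 / 4) * ((n : ℝ) + 1) ^ (1 + (m + ε)) with hA
  have hA0 : 0 ≤ A := tsum_nonneg fun n => by positivity
  refine ⟨2 * (C * A) + 1, max T₁ 1, by positivity, le_max_right _ _, fun T hT => ?_⟩
  have hT1 : 1 ≤ T := (le_max_right _ _).trans hT
  have hT0 : 0 < T := by linarith
  set Z : ℝ → ℝ := fun u => ‖riemannZeta (critPt u)‖ ^ κ with hZ
  have hZ0 : ∀ u, 0 ≤ Z u := fun u => by positivity
  have hZc : Continuous Z := continuous_zeta_critPt.norm.rpow_const fun _ => Or.inr hκ.le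
  have hmom : ∀ X, T ≤ X → ∫ u in (0 : ℝ)..X, Z u ≤ C * X ^ (1 + (m + ε)) := by
    intro X hX
    have hX0 : 0 < X := by linarith
    have h1 := hT₁ X (((le_max_left _ _).trans hT).trans hX)
    rw [Real.norm_of_nonneg (Real.rpow_nonneg hX0.le _)] at h1
    have h2 := (le_abs_self _).trans h1
    change 1 / X * ∫ u in (0 : ℝ)..X, Z u ≤ _ at h2
    rw [one_div, inv_mul_le_iff₀ hX0] at h2
    rw [Real.rpow_add hX0, Real.rpow_one]
    linarith
  set g : ℝ → ℝ := fun u => gaussianPDFReal 0 ((T ^ 2).toNNReal + 1) u * Z u with hg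
  have hgc : Continuous g := by
    refine Continuous.mul ?_ hZc
    unfold gaussianPDFReal
    fun_prop
  have hgi : Integrable g := by
    have hi := integrable_zeta_rpow_gaussianReal hκ ((T ^ 2).toNNReal + 1)
    rw [gaussianReal_of_var_ne_zero _ (by simp)] at hi
    rw [integrable_withDensity_iff_integrable_smul' (measurable_gaussianPDF _ _)
      (Eventually.of_forall fun x => gaussianPDF_lt_top)] at hi
    refine hi.congr (Eventually.of_forall fun u => ?_)
    simp [hg, hZ, toReal_gaussianPDF]
  have hpiece : ∀ n : ℕ, ∫ u in (n * T)..((n + 1 : ℕ) * T), g u ≤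
      C * T ^ (m + ε) * (Real.exp (-(n : ℝ) ^ 2 / 4) * ((n : ℝ) + 1) ^ (1 + (m + ε))) := by
    intro n
    have hn1 : (0 : ℝ) < (n : ℝ) + 1 := by positivity
    have hle : (n : ℝ) * T ≤ (n + 1 : ℕ) * T := by push_cast; nlinarith
    have h1 : ∫ u in (n * T)..((n + 1 : ℕ) * T), g u ≤
        ∫ u in (n * T)..((n + 1 : ℕ) * T), 1 / T * Real.exp (-(n : ℝ) ^ 2 / 4) * Z u := by
      refine intervalIntegral.integral_mono_on hle (hgc.intervalIntegrable _ _)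
        ((hZc.const_mul _).intervalIntegrable _ _) fun u hu => ?_
      exact mul_le_mul_of_nonneg_right (gaussianPDFReal_window_le hT1 hu.1) (hZ0 u)
    rw [intervalIntegral.integral_const_mul] at h1
    have h2 : ∫ u in (n * T)..((n + 1 : ℕ) * T), Z u ≤ ∫ u in (0 : ℝ)..((n + 1 : ℕ) * T), Z u := by
      rw [← intervalIntegral.integral_add_adjacent_intervals (hZc.intervalIntegrable 0 (n * T))
        (hZc.intervalIntegrable _ _)]
      have := intervalIntegral.integral_nonneg (μ := volume)
        (show (0 : ℝ) ≤ n * T by positivity) fun u _ => hZ0 u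
      linarith
    have h3 := hmom ((n + 1 : ℕ) * T) (by push_cast; nlinarith [(Nat.cast_nonneg n : (0 : ℝ) ≤ n)])
    refine h1.trans ((mul_le_mul_of_nonneg_left (h2.trans h3) (by positivity)).trans (le_of_eq ?_))
    push_cast
    rw [Real.mul_rpow hn1.le hT0.le, Real.rpow_add hT0 1, Real.rpow_one]
    field_simp
  have hpart : ∀ N : ℕ, ∫ u in (0 : ℝ)..(N * T), g u ≤ C * T ^ (m + ε) * A := by
    intro N
    have h1 := intervalIntegral.sum_integral_adjacent_intervals (μ := volume) (f := g)
      (a := fun n : ℕ => (n : ℝ) * T) (n := N) fun k _ => hgc.intervalIntegrable _ _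
    simp only [Nat.cast_zero, zero_mul] at h1
    rw [← h1]
    refine (Finset.sum_le_sum fun n _ => hpiece n).trans ?_
    rw [← Finset.mul_sum]
    refine mul_le_mul_of_nonneg_left ?_ (by positivity)
    exact (summable_exp_neg_sq_mul_rpow _).sum_le_tsum _ fun n _ => by positivity
  have hlim := intervalIntegral_tendsto_integral_Ioi 0 hgi.integrableOn
    (tendsto_natCast_atTop_atTop.atTop_mul_const hT0 : Tendsto (fun N : ℕ => (N : ℝ) * T) _ _)
  have hfin := le_of_tendsto hlim (Eventually.of_forall hpart)
  rw [gaussianMoment_eq]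
  have : 0 ≤ T ^ (m + ε) := by positivity
  linarith

/-- Moments of ζ cannot decay. The form with K = 1 and one unit weight equals 1, so
`exists_logForm_le` gives 1 ≤ D(1/T + L + L^(1-κ/2) M) with M the moment; for L = 1/(4D) and m < 0
the right side tends to 1/4. -/
theorem ZetaMomentBound.nonneg {κ m : ℝ} (hκ : 2 ≤ κ) (h : ZetaMomentBound κ m) : 0 ≤ m := by
  by_contra hm
  push Not at hm
  obtain ⟨C, T₀, hC, hT₀, hM⟩ := h.exists_gaussianMoment_le (by linarith) (ε := -m / 2) (by linarith)
  obtain ⟨D, hD, hform⟩ := exists_logForm_le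
  set L := 1 / (4 * D) with hL
  have hL0 : 0 < L := by positivity
  have hev : ∀ᶠ T : ℝ in atTop, D * (1 / T + L + L ^ (1 - κ / 2) * (C * T ^ (m + -m / 2))) < 1 := by
    have h1 : Tendsto (fun T : ℝ => T ^ (m + -m / 2)) atTop (𝓝 0) := by
      have := tendsto_rpow_neg_atTop (y := -(m / 2)) (by linarith)
      simpa [show -(-(m / 2)) = m + -m / 2 by ring] using this
    have h2 : Tendsto (fun T : ℝ => 1 / T) atTop (𝓝 0) := by
      simpa using tendsto_inv_atTop_zero (𝕜 := ℝ)
    have h3 := ((h2.add_const L).add ((h1.const_mul C).const_mul (L ^ (1 - κ / 2)))).const_mul D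
    refine h3.eventually_lt_const ?_
    rw [mul_zero, mul_zero, add_zero, zero_add, hL]
    field_simp
    norm_num
  obtain ⟨T, h1, h2⟩ := (hev.and (eventually_ge_atTop T₀)).exists
  have h3 := hform κ T L 1 {0} (fun _ => 1) hκ (by linarith) hL0 le_rfl fun _ => zero_le_one
  have h4 : logForm T 1 {0} (fun _ => 1) = 1 := by
    simp [logForm]
  rw [h4] at h3
  simp only [Nat.cast_one, Finset.sum_singleton, one_pow, mul_one, one_mul] at h3
  have h5 : L ^ (1 - κ / 2) * gaussianMoment κ T ≤ L ^ (1 - κ / 2) * (C * T ^ (m + -m / 2)) :=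
    mul_le_mul_of_nonneg_left (hM T h2) (by positivity)
  have h6 := mul_le_mul_of_nonneg_left (add_le_add_right h5 (1 / T + L)) hD.le
  linarith

/-! ### Counting close dilates -/

section Counting

open Classical

variable {ι : Type*}

theorem card_filter_eq_sum_mul (A B : Finset ι) (f g : ι → ℤ) {U : Finset ℤ}
    (hU : ∀ p ∈ A, f p ∈ U) :
    ((A ×ˢ B).filter fun r => f r.1 = g r.2).card =
      ∑ n ∈ U, (A.filter fun p => f p = n).card * (B.filter fun q => g q = n).card := by
  rw [Finset.card_eq_sum_card_fiberwise (f := fun r : ι × ι => f r.1) (t := U)]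
  · refine Finset.sum_congr rfl fun n _ => ?_
    rw [← Finset.card_product]
    congr 1
    ext ⟨p, q⟩
    simp only [Finset.mem_filter, Finset.mem_product]
    constructor
    · rintro ⟨⟨⟨h1, h2⟩, h3⟩, h4⟩
      exact ⟨⟨h1, h4⟩, h2, h3 ▸ h4⟩
    · rintro ⟨⟨h1, h4⟩, h2, h5⟩
      exact ⟨⟨⟨h1, h2⟩, h4.trans h5.symm⟩, h4⟩
  · intro r hr
    simp only [Finset.coe_filter, Finset.mem_product, Set.mem_ofPred_eq] at hr
    exact hU _ hr.1.1

/-- Cauchy–Schwarz over the common value of `f` and `g`. -/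
theorem card_filter_eq_le_sqrt (A B : Finset ι) (f g : ι → ℤ) :
    (((A ×ˢ B).filter fun r => f r.1 = g r.2).card : ℝ) ≤
      Real.sqrt ((A ×ˢ A).filter fun r => f r.1 = f r.2).card *
        Real.sqrt ((B ×ˢ B).filter fun r => g r.1 = g r.2).card := by
  set U := A.image f ∪ B.image g
  have hA : ∀ p ∈ A, f p ∈ U := fun p hp =>
    Finset.mem_union_left _ (Finset.mem_image_of_mem f hp)
  have hB : ∀ p ∈ B, g p ∈ U := fun p hp =>
    Finset.mem_union_right _ (Finset.mem_image_of_mem g hp)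
  rw [card_filter_eq_sum_mul A B f g hA, card_filter_eq_sum_mul A A f f hA,
    card_filter_eq_sum_mul B B g g hB, ← Real.sqrt_mul (Nat.cast_nonneg _)]
  refine Real.le_sqrt_of_sq_le ?_
  push_cast
  simp_rw [← pow_two]
  exact Finset.sum_mul_sq_le_sq_mul_sq U _ _

/-- There are 2D + 1 possible differences, and translating `g` by one of them leaves the
coincidences of `g` with itself unchanged. -/
theorem card_filter_abs_sub_le (A B : Finset ι) (f g : ι → ℤ) (D : ℕ) :
    (((A ×ˢ B).filter fun r => |f r.1 - g r.2| ≤ D).card : ℝ) ≤ (2 * D + 1) *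
      (Real.sqrt ((A ×ˢ A).filter fun r => f r.1 = f r.2).card *
        Real.sqrt ((B ×ˢ B).filter fun r => g r.1 = g r.2).card) := by
  have hsub : ((A ×ˢ B).filter fun r => |f r.1 - g r.2| ≤ D) ⊆
      (Finset.Icc (-(D : ℤ)) D).biUnion fun d => (A ×ˢ B).filter fun r => f r.1 = g r.2 + d := by
    intro r hr
    rw [Finset.mem_filter, abs_le] at hr
    refine Finset.mem_biUnion.2 ⟨f r.1 - g r.2, Finset.mem_Icc.2 hr.2, ?_⟩
    exact Finset.mem_filter.2 ⟨hr.1, by ring⟩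
  have h1 := (Finset.card_le_card hsub).trans Finset.card_biUnion_le
  have h2 : (((A ×ˢ B).filter fun r => |f r.1 - g r.2| ≤ D).card : ℝ) ≤
      ∑ d ∈ Finset.Icc (-(D : ℤ)) D, (((A ×ˢ B).filter fun r => f r.1 = g r.2 + d).card : ℝ) := by
    exact_mod_cast h1
  refine h2.trans ?_
  have h3 : ∀ d ∈ Finset.Icc (-(D : ℤ)) D,
      (((A ×ˢ B).filter fun r => f r.1 = g r.2 + d).card : ℝ) ≤
      Real.sqrt ((A ×ˢ A).filter fun r => f r.1 = f r.2).card *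
        Real.sqrt ((B ×ˢ B).filter fun r => g r.1 = g r.2).card := by
    intro d _
    simpa using card_filter_eq_le_sqrt A B f (fun q => g q + d)
  refine (Finset.sum_le_card_nsmul _ _ _ h3).trans (le_of_eq ?_)
  rw [nsmul_eq_mul, Int.card_Icc]
  congr 1
  have : ((D : ℤ) + 1 - -(D : ℤ)).toNat = 2 * D + 1 := by omega
  rw [this]
  push_cast
  rfl

/-- The number of ordered pairs of indices whose values are at distance less than `1`. -/
noncomputable def closePairs (P : Finset ι) (z : ι → ℝ) : ℕ :=
  ((P ×ˢ P).filter fun r => |z r.1 - z r.2| < 1).card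

/-- Dividing by j ≥ 1 leaves |z_p - ρ z_q| ≤ H with ρ = l/j ≥ 1/2. Doubling before taking floors
makes the cells fine enough that equal cells force |z - z'| < 1 even after scaling by ρ. The floors
differ by at most 2H + 1, so the factor is 2(2H + 1) + 1 ≤ 9H. -/
theorem card_filter_dilate_le (A B : Finset ι) (z : ι → ℝ) {K j l H : ℕ} (hK : 1 ≤ K)
    (hj : j ∈ Finset.Ico K (2 * K)) (hl : l ∈ Finset.Ico K (2 * K)) (hH : 1 ≤ H) :
    (((A ×ˢ B).filter fun r => |j * z r.1 - l * z r.2| ≤ H).card : ℝ) ≤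
      9 * H * (Real.sqrt (closePairs A z) * Real.sqrt (closePairs B z)) := by
  rw [Finset.mem_Ico] at hj hl
  have hj0 : (1 : ℝ) ≤ j := by exact_mod_cast (by omega : 1 ≤ j)
  have hjl : (j : ℝ) ≤ 2 * l := by exact_mod_cast (by omega : j ≤ 2 * l)
  set ρ : ℝ := l / j with hρ
  have hρ1 : 1 / 2 ≤ ρ := by rw [hρ, le_div_iff₀ (by linarith)]; linarith
  set f : ι → ℤ := fun p => ⌊2 * z p⌋ with hf
  set g : ι → ℤ := fun q => ⌊2 * (ρ * z q)⌋ with hg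
  have h1 : (((A ×ˢ B).filter fun r => |j * z r.1 - l * z r.2| ≤ H).card : ℝ) ≤
      ((A ×ˢ B).filter fun r => |f r.1 - g r.2| ≤ (2 * H + 1 : ℕ)).card := by
    refine Nat.cast_le.2 (Finset.card_le_card fun r hr => ?_)
    rw [Finset.mem_filter] at hr ⊢
    refine ⟨hr.1, ?_⟩
    have h2 : |z r.1 - ρ * z r.2| ≤ H := by
      have h3 : j * z r.1 - l * z r.2 = j * (z r.1 - ρ * z r.2) := by
        rw [hρ]; field_simp
      have h4 := hr.2
      rw [h3, abs_mul, abs_of_pos (by linarith)] at h4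
      nlinarith [abs_nonneg (z r.1 - ρ * z r.2)]
    have h5 : |((f r.1 - g r.2 : ℤ) : ℝ)| < 2 * H + 1 := by
      push_cast
      rw [abs_le] at h2
      rw [abs_lt]
      have e1 := Int.floor_le (2 * z r.1)
      have e2 := Int.lt_floor_add_one (2 * z r.1)
      have e3 := Int.floor_le (2 * (ρ * z r.2))
      have e4 := Int.lt_floor_add_one (2 * (ρ * z r.2))
      simp only [hf, hg]
      constructor <;> linarith
    exact_mod_cast h5.le
  have hA : ((A ×ˢ A).filter fun r => f r.1 = f r.2).card ≤ closePairs A z := by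
    refine Finset.card_le_card (Finset.monotone_filter_right _ fun r _ hr => ?_)
    have := Int.abs_sub_lt_one_of_floor_eq_floor hr
    rw [← mul_sub, abs_mul, abs_two] at this
    linarith [abs_nonneg (z r.1 - z r.2)]
  have hB : ((B ×ˢ B).filter fun r => g r.1 = g r.2).card ≤ closePairs B z := by
    refine Finset.card_le_card (Finset.monotone_filter_right _ fun r _ hr => ?_)
    have := Int.abs_sub_lt_one_of_floor_eq_floor hr
    rw [← mul_sub, ← mul_sub, ← mul_assoc, abs_mul, abs_of_pos (by linarith)] at this
    nlinarith [abs_nonneg (z r.1 - z r.2)]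
  refine h1.trans ((card_filter_abs_sub_le A B f g _).trans ?_)
  have hH' : (1 : ℝ) ≤ H := by exact_mod_cast hH
  refine mul_le_mul ?_ ?_ (by positivity) (by positivity)
  · push_cast; linarith
  · exact mul_le_mul (Real.sqrt_le_sqrt (by exact_mod_cast hA))
      (Real.sqrt_le_sqrt (by exact_mod_cast hB)) (Real.sqrt_nonneg _) (Real.sqrt_nonneg _)

/-- Close dilates lie in logarithmic windows of width `1 / T` at bounded distance. -/
theorem abs_log_window_sub_le {T B H x y : ℝ} {K j l : ℕ} (hT : 0 < T) (hB : 0 < B) (hK : 1 ≤ K)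
    (hTB : T * H ≤ K * B) (hj : K ≤ j) (hl : K ≤ l) (hx : B ≤ x) (hy : B ≤ y)
    (h : |j * x - l * y| ≤ H) :
    |T * (Real.log j - Real.log l) + (⌊T * Real.log x⌋ - ⌊T * Real.log y⌋)| ≤ 2 := by
  have hK0 : (0 : ℝ) < K := by exact_mod_cast hK
  have hjK : (K : ℝ) ≤ j := by exact_mod_cast hj
  have hlK : (K : ℝ) ≤ l := by exact_mod_cast hl
  have hj0 : (0 : ℝ) < j := by linarith
  have hl0 : (0 : ℝ) < l := by linarith
  have hx0 : 0 < x := by linarith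
  have hy0 : 0 < y := by linarith
  -- log a - log b ≤ (a - b)/b ≤ H/(KB) ≤ 1/T. Of the final bound 2, one unit comes from here and
  -- one from the floors.
  have key : ∀ a b : ℝ, K * B ≤ a → K * B ≤ b → a - b ≤ H → T * (Real.log a - Real.log b) ≤ 1 := by
    intro a b ha hb hab
    have hKB : 0 < K * B := by positivity
    have ha0 : 0 < a := by linarith
    have hb0 : 0 < b := by linarith
    have h1 := Real.log_le_sub_one_of_pos (div_pos ha0 hb0)
    rw [Real.log_div ha0.ne' hb0.ne'] at h1
    have h2 : a / b - 1 = (a - b) / b := by field_simp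
    have h3 : T * ((a - b) / b) ≤ 1 := by
      rw [← mul_div_assoc, div_le_one hb0]
      nlinarith
    rw [h2] at h1
    exact (mul_le_mul_of_nonneg_left h1 hT.le).trans h3
  rw [abs_le] at h
  have hjx : K * B ≤ j * x := mul_le_mul hjK hx hB.le hj0.le
  have hly : K * B ≤ l * y := mul_le_mul hlK hy hB.le hl0.le
  have k1 := key _ _ hjx hly h.2
  have k2 := key _ _ hly hjx (by linarith [h.1])
  rw [Real.log_mul hj0.ne' hx0.ne', Real.log_mul hl0.ne' hy0.ne'] at k1 k2
  have e1 := Int.floor_le (T * Real.log x)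
  have e2 := Int.lt_floor_add_one (T * Real.log x)
  have e3 := Int.floor_le (T * Real.log y)
  have e4 := Int.lt_floor_add_one (T * Real.log y)
  rw [abs_le]
  constructor <;> nlinarith

/-- Windows collect the p with a given ⌊T log z_p⌋, and v_k is the square root of the number of
close pairs inside window k. By Cauchy–Schwarz a pair of windows contributes at most 9H v_k v_k',
and it contributes only if its Gaussian factor is at least e^(-2). Disjointness of the windows
bounds ∑ v_k² by the close pairs of P; trivially v_k is at most the size of its window. -/
theorem exists_window_weights (P : Finset ι) {z : ι → ℝ} {T B : ℝ} {K H : ℕ} (hT : 0 < T)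
    (hB : 0 < B) (hK : 1 ≤ K) (hH : 1 ≤ H) (hTB : T * H ≤ K * B) (hz : ∀ p ∈ P, B ≤ z p) :
    ∃ (S : Finset ℤ) (v : ℤ → ℝ), (∀ k, 0 ≤ v k) ∧ ∑ k ∈ S, v k ≤ P.card ∧
      ∑ k ∈ S, v k ^ 2 ≤ closePairs P z ∧
      ∑ j ∈ Finset.Ico K (2 * K), ∑ l ∈ Finset.Ico K (2 * K),
        (((P ×ˢ P).filter fun r => |j * z r.1 - l * z r.2| ≤ H).card : ℝ) ≤
        9 * H * Real.exp 2 * logForm T K S v := by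
  set w : ι → ℤ := fun p => ⌊T * Real.log (z p)⌋ with hw
  set Q : ℤ → Finset ι := fun k => P.filter fun p => w p = k with hQ
  set S := P.image w with hS
  set v : ℤ → ℝ := fun k => Real.sqrt (closePairs (Q k) z) with hv
  have hmaps : ∀ p ∈ P, w p ∈ S := fun p hp => Finset.mem_image_of_mem w hp
  have hcardQ : ∀ k, v k ≤ (Q k).card := fun k => by
    refine Real.sqrt_le_iff.2 ⟨Nat.cast_nonneg _, ?_⟩
    have : closePairs (Q k) z ≤ (Q k).card ^ 2 := by
      rw [pow_two, ← Finset.card_product]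
      exact Finset.card_filter_le _ _
    exact_mod_cast this
  refine ⟨S, v, fun k => Real.sqrt_nonneg _, ?_, ?_, ?_⟩
  · refine (Finset.sum_le_sum fun k _ => hcardQ k).trans (le_of_eq ?_)
    rw [Finset.card_eq_sum_card_fiberwise hmaps]
    push_cast
    rfl
  · have h1 : ∀ k, v k ^ 2 = closePairs (Q k) z := fun k => Real.sq_sqrt (Nat.cast_nonneg _)
    simp_rw [h1]
    rw [← Nat.cast_sum]
    refine Nat.cast_le.2 ?_
    unfold closePairs
    rw [← Finset.card_biUnion]
    · refine Finset.card_le_card fun r hr => ?_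
      simp only [Finset.mem_biUnion, Finset.mem_filter, Finset.mem_product, hQ] at hr ⊢
      obtain ⟨k, _, ⟨⟨h1, _⟩, h2, _⟩, h3⟩ := hr
      exact ⟨⟨h1, h2⟩, h3⟩
    · intro k _ k' _ hkk
      refine Finset.disjoint_left.2 fun r hr hr' => hkk ?_
      simp only [Finset.mem_filter, Finset.mem_product, hQ] at hr hr'
      exact hr.1.1.2.symm.trans hr'.1.1.2
  · have hsplit : ∀ j l : ℕ, (((P ×ˢ P).filter fun r => |j * z r.1 - l * z r.2| ≤ H).card : ℝ) ≤
        ∑ k ∈ S, ∑ k' ∈ S,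
          (((Q k ×ˢ Q k').filter fun r => |j * z r.1 - l * z r.2| ≤ H).card : ℝ) := by
      intro j l
      rw [← Finset.sum_product']
      have hsub : ((P ×ˢ P).filter fun r => |j * z r.1 - l * z r.2| ≤ H) ⊆
          (S ×ˢ S).biUnion fun kk => (Q kk.1 ×ˢ Q kk.2).filter
            fun r => |j * z r.1 - l * z r.2| ≤ H := by
        intro r hr
        simp only [Finset.mem_biUnion, Finset.mem_filter, Finset.mem_product, hQ] at hr ⊢
        exact ⟨(w r.1, w r.2), ⟨hmaps _ hr.1.1, hmaps _ hr.1.2⟩,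
          ⟨⟨hr.1.1, rfl⟩, hr.1.2, rfl⟩, hr.2⟩
      have := (Finset.card_le_card hsub).trans Finset.card_biUnion_le
      exact_mod_cast this
    have hterm : ∀ j ∈ Finset.Ico K (2 * K), ∀ l ∈ Finset.Ico K (2 * K), ∀ k k' : ℤ,
        (((Q k ×ˢ Q k').filter fun r => |j * z r.1 - l * z r.2| ≤ H).card : ℝ) ≤
          9 * H * Real.exp 2 * (v k * v k' *
            Real.exp (-(T * (Real.log j - Real.log l) + (k - k')) ^ 2 / 2)) := by
      intro j hj l hl k k'
      have hvk : 0 ≤ v k * v k' := mul_nonneg (Real.sqrt_nonneg _) (Real.sqrt_nonneg _)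
      rcases Finset.eq_empty_or_nonempty
        ((Q k ×ˢ Q k').filter fun r => |j * z r.1 - l * z r.2| ≤ H) with h0 | ⟨r, hr⟩
      · rw [h0, Finset.card_empty, Nat.cast_zero]
        positivity
      · refine (card_filter_dilate_le _ _ z hK hj hl hH).trans ?_
        simp only [Finset.mem_filter, Finset.mem_product, hQ] at hr
        have hwin := abs_log_window_sub_le hT hB hK hTB (Finset.mem_Ico.1 hj).1
          (Finset.mem_Ico.1 hl).1 (hz _ hr.1.1.1) (hz _ hr.1.2.1) hr.2
        have e1 : ⌊T * Real.log (z r.1)⌋ = k := hr.1.1.2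
        have e2 : ⌊T * Real.log (z r.2)⌋ = k' := hr.1.2.2
        rw [e1, e2] at hwin
        have hsq : (T * (Real.log j - Real.log l) + (k - k')) ^ 2 ≤ 2 ^ 2 := by
          rw [← sq_abs]
          exact pow_le_pow_left₀ (abs_nonneg _) hwin 2
        have hexp : 1 ≤ Real.exp 2 *
            Real.exp (-(T * (Real.log j - Real.log l) + (k - k')) ^ 2 / 2) := by
          rw [← Real.exp_add]
          exact Real.one_le_exp (by linarith)
        change 9 * (H : ℝ) * (v k * v k') ≤ _
        have := mul_le_mul_of_nonneg_left hexp (show 0 ≤ 9 * (H : ℝ) * (v k * v k') by positivity)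
        linarith
    refine (Finset.sum_le_sum fun j hj => Finset.sum_le_sum fun l hl => (hsplit j l).trans
      (Finset.sum_le_sum fun k _ => Finset.sum_le_sum fun k' _ => hterm j hj l hl k k')).trans
        (le_of_eq ?_)
    simp_rw [← Finset.mul_sum]
    congr 1
    rw [logForm, Finset.sum_product]
    refine Finset.sum_congr rfl fun j _ => ?_
    rw [Finset.sum_comm]
    refine Finset.sum_congr rfl fun k _ => ?_
    rw [Finset.sum_product]

end Counting

/-! ### A cosine kernel and the second moment over α -/

theorem two_mul_distNearestInt_le_abs_sin (t : ℝ) :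
    2 * distNearestInt t ≤ |Real.sin (Real.pi * t)| := by
  set u := t - round t with hu
  have hu1 : |u| ≤ 1 / 2 := abs_sub_round t
  have h1 : |Real.sin (Real.pi * t)| = |Real.sin (Real.pi * u)| := by
    have : Real.pi * u = Real.pi * t - (round t : ℤ) * Real.pi := by rw [hu]; ring
    rw [this, Real.sin_sub_int_mul_pi, abs_mul, abs_zpow]
    simp
  have hpi := Real.pi_pos
  have h2 : |Real.pi * u| ≤ Real.pi / 2 := by
    rw [abs_mul, abs_of_pos hpi]; nlinarith
  have h3 := Real.mul_abs_le_abs_sin h2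
  rw [abs_mul, abs_of_pos hpi] at h3
  rw [h1, distNearestInt]
  refine le_trans (le_of_eq ?_) h3
  rw [← hu]
  field_simp

theorem norm_sq_exp_sum {ι : Type*} (s : Finset ι) (a x : ι → ℝ) :
    ‖∑ i ∈ s, (a i : ℂ) * Complex.exp (x i * Complex.I)‖ ^ 2 =
      ∑ i ∈ s, ∑ j ∈ s, a i * a j * Real.cos (x i - x j) := by
  have hre : (∑ i ∈ s, (a i : ℂ) * Complex.exp (x i * Complex.I)).re =
      ∑ i ∈ s, a i * Real.cos (x i) := by
    rw [Complex.re_sum]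
    exact Finset.sum_congr rfl fun i _ => by
      rw [Complex.re_ofReal_mul, Complex.exp_ofReal_mul_I_re]
  have him : (∑ i ∈ s, (a i : ℂ) * Complex.exp (x i * Complex.I)).im =
      ∑ i ∈ s, a i * Real.sin (x i) := by
    rw [Complex.im_sum]
    exact Finset.sum_congr rfl fun i _ => by
      rw [Complex.im_ofReal_mul, Complex.exp_ofReal_mul_I_im]
  rw [Complex.sq_norm, Complex.normSq_apply, hre, him, Finset.sum_mul_sum, Finset.sum_mul_sum,
    ← Finset.sum_add_distrib]
  refine Finset.sum_congr rfl fun i _ => ?_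
  rw [← Finset.sum_add_distrib]
  refine Finset.sum_congr rfl fun j _ => ?_
  rw [Real.cos_sub]
  ring

theorem norm_geom_sum_le (J : ℕ) {t : ℝ} (ht : 0 < distNearestInt t) :
    ‖∑ i ∈ Finset.range J, Complex.exp (Complex.I * (2 * Real.pi * t : ℝ)) ^ i‖ ≤
      1 / (2 * distNearestInt t) := by
  set e := Complex.exp (Complex.I * (2 * Real.pi * t : ℝ)) with he
  have h1 : ‖e - 1‖ = 2 * |Real.sin (Real.pi * t)| := by
    rw [he, Complex.norm_exp_I_mul_ofReal_sub_one, Real.norm_eq_abs, abs_mul, abs_two]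
    congr 3
    ring
  have h2 := two_mul_distNearestInt_le_abs_sin t
  have h3 : 0 < ‖e - 1‖ := by rw [h1]; linarith
  have hen : ‖e‖ = 1 := by rw [he, mul_comm, Complex.norm_exp_ofReal_mul_I]
  rw [geom_sum_eq (sub_ne_zero.1 (norm_pos_iff.1 h3)), norm_div, div_le_div_iff₀ h3 (by linarith)]
  have h4 : ‖e ^ J - 1‖ ≤ 2 := by
    refine (norm_sub_le _ _).trans ?_
    rw [norm_pow, hen]
    norm_num
  rw [h1]
  have hd : 0 ≤ 2 * distNearestInt t := by linarith
  nlinarith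

/-- A nonnegative cosine polynomial of degree less than `M`, concentrated near the integers. -/
theorem exists_cos_kernel {J r M : ℕ} (hM : 1 ≤ M) (hJ : r * (J - 1) < M) :
    ∃ c : ℕ → ℝ, (∀ j, 0 ≤ c j) ∧ (∀ j, c j ≤ 2 * c 0) ∧ (J : ℝ) ^ (2 * r) / M ≤ c 0 ∧
      ∀ t, 0 < distNearestInt t → ∑ j ∈ Finset.range M, c j * Real.cos (2 * Real.pi * t * j) ≤
        (1 / (2 * distNearestInt t)) ^ (2 * r) := by
  -- The kernel is |p(e^(2πit))|² for a power of a geometric sum. Raising r makes it decay faster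
  -- away from the integers, relative to its constant term.
  set p : Polynomial ℝ := (∑ i ∈ Finset.range J, Polynomial.X ^ i) ^ r with hp
  set a : ℕ → ℝ := fun n => p.coeff n with ha
  have hdeg : p.natDegree < M := by
    refine lt_of_le_of_lt ?_ hJ
    refine Polynomial.natDegree_pow_le.trans (Nat.mul_le_mul_left _ ?_)
    refine Polynomial.natDegree_sum_le_of_forall_le _ _ fun i hi => ?_
    rw [Polynomial.natDegree_X_pow]
    have := Finset.mem_range.1 hi
    omega
  have ha0 : ∀ n, 0 ≤ a n := by
    have hmap : p = ((∑ i ∈ Finset.range J, Polynomial.X ^ i : Polynomial ℕ) ^ r).map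
        (Nat.castRingHom ℝ) := by
      rw [hp, Polynomial.map_pow, Polynomial.map_sum]
      simp
    intro n
    simp only [ha, hmap, Polynomial.coeff_map]
    simp
  set D : ℕ → Finset (ℕ × ℕ) := fun j =>
    (Finset.range M ×ˢ Finset.range M).filter fun q => ((q.1 : ℤ) - q.2).natAbs = j with hD
  -- Autocorrelations of the coefficients, with the differences ±j folded together; this is why c j
  -- may reach 2 c 0. The bounds on c are AM-GM, and Cauchy–Schwarz with p(1) = J^r.
  set c : ℕ → ℝ := fun j => ∑ q ∈ D j, a q.1 * a q.2 with hc
  have hc0 : c 0 = ∑ n ∈ Finset.range M, a n ^ 2 := by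
    have hdiag : D 0 = (Finset.range M).diag := by
      ext ⟨n, n'⟩
      simp only [hD, Finset.mem_filter, Finset.mem_product, Finset.mem_diag, Finset.mem_range]
      omega
    simp only [hc, hdiag, Finset.sum_diag, pow_two]
  refine ⟨c, fun j => Finset.sum_nonneg fun q _ => mul_nonneg (ha0 _) (ha0 _), ?_, ?_, ?_⟩
  · intro j
    have hswap : ∑ q ∈ D j, a q.2 ^ 2 = ∑ q ∈ D j, a q.1 ^ 2 := by
      refine Finset.sum_nbij' Prod.swap Prod.swap ?_ ?_ (fun _ _ => rfl) (fun _ _ => rfl)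
        (fun _ _ => rfl) <;>
      · rintro ⟨n, n'⟩ h
        simp only [hD, Finset.mem_filter, Finset.mem_product, Prod.swap_prod_mk,
          Finset.mem_range] at h ⊢
        omega
    have h1 : c j ≤ ∑ q ∈ D j, a q.1 ^ 2 := by
      have h2 : c j ≤ ∑ q ∈ D j, (1 / 2 * a q.1 ^ 2 + 1 / 2 * a q.2 ^ 2) :=
        Finset.sum_le_sum fun q _ => by nlinarith [sq_nonneg (a q.1 - a q.2)]
      rw [Finset.sum_add_distrib, ← Finset.mul_sum, ← Finset.mul_sum, hswap] at h2
      linarith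
    refine h1.trans ?_
    have hmaps : ∀ q ∈ D j, q.1 ∈ Finset.range M := fun q hq =>
      (Finset.mem_product.1 (Finset.mem_filter.1 hq).1).1
    rw [← Finset.sum_fiberwise_of_maps_to hmaps, hc0, Finset.mul_sum]
    refine Finset.sum_le_sum fun n _ => ?_
    rw [Finset.sum_congr rfl (g := fun _ => a n ^ 2) fun q hq => by
      rw [(Finset.mem_filter.1 hq).2], Finset.sum_const, nsmul_eq_mul]
    refine mul_le_mul_of_nonneg_right ?_ (sq_nonneg _)
    have hsub : ((D j).filter fun q => q.1 = n) ⊆ {(n, n + j), (n, n - j)} := by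
      rintro ⟨m, m'⟩ h
      simp only [hD, Finset.mem_filter, Finset.mem_product, Finset.mem_range,
        Finset.mem_insert, Finset.mem_singleton, Prod.mk.injEq] at h ⊢
      omega
    exact_mod_cast (Finset.card_le_card hsub).trans Finset.card_le_two
  · rw [hc0, div_le_iff₀ (by exact_mod_cast hM)]
    have h1 : ∑ n ∈ Finset.range M, a n = (J : ℝ) ^ r := by
      have h2 := Polynomial.eval_eq_sum_range' hdeg (1 : ℝ)
      simp only [one_pow, mul_one] at h2
      rw [← h2, hp, Polynomial.eval_pow, Polynomial.eval_finsetSum]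
      simp
    have h3 := sq_sum_le_card_mul_sum_sq (s := Finset.range M) (f := a)
    rw [h1, Finset.card_range, ← pow_mul] at h3
    rw [mul_comm 2 r]
    linarith
  · intro t ht
    set e := Complex.exp (Complex.I * (2 * Real.pi * t : ℝ)) with he
    have hpow : ∀ n : ℕ, e ^ n = Complex.exp ((2 * Real.pi * t * n : ℝ) * Complex.I) := by
      intro n
      rw [he, ← Complex.exp_nat_mul]
      congr 1
      push_cast
      ring
    have heval : ∑ n ∈ Finset.range M, (a n : ℂ) * e ^ n =
        (∑ i ∈ Finset.range J, e ^ i) ^ r := by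
      have h2 := Polynomial.eval₂_eq_sum_range' (algebraMap ℝ ℂ) hdeg e
      rw [hp, Polynomial.eval₂_pow, Polynomial.eval₂_finsetSum] at h2
      simp only [Polynomial.eval₂_X_pow] at h2
      rw [h2]
      rfl
    have hsq : ‖∑ n ∈ Finset.range M, (a n : ℂ) * e ^ n‖ ^ 2 =
        ∑ j ∈ Finset.range M, c j * Real.cos (2 * Real.pi * t * j) := by
      have hmaps : ∀ q ∈ Finset.range M ×ˢ Finset.range M,
          ((q.1 : ℤ) - q.2).natAbs ∈ Finset.range M := by
        rintro ⟨n, n'⟩ h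
        simp only [Finset.mem_product, Finset.mem_range] at h ⊢
        omega
      have h1 : ∑ j ∈ Finset.range M, c j * Real.cos (2 * Real.pi * t * j) =
          ∑ q ∈ Finset.range M ×ˢ Finset.range M,
            a q.1 * a q.2 * Real.cos (2 * Real.pi * t * ((q.1 : ℝ) - q.2)) := by
        rw [← Finset.sum_fiberwise_of_maps_to hmaps]
        refine Finset.sum_congr rfl fun j _ => ?_
        rw [hc, Finset.sum_mul]
        refine Finset.sum_congr rfl fun q hq => ?_
        have hq2 := (Finset.mem_filter.1 hq).2
        have habs : (j : ℝ) = |(q.1 : ℝ) - q.2| := by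
          rw [← hq2]
          have := Nat.cast_natAbs (α := ℝ) ((q.1 : ℤ) - q.2)
          rw [this]
          push_cast
          rfl
        rw [habs]
        congr 1
        rcases abs_choice ((q.1 : ℝ) - q.2) with h | h <;> rw [h]
        rw [mul_neg, Real.cos_neg]
      simp_rw [hpow]
      rw [h1, Finset.sum_product, norm_sq_exp_sum]
      simp_rw [mul_sub]
    rw [← hsq, heval, norm_pow, ← pow_mul, mul_comm r 2]
    exact pow_le_pow_left₀ (norm_nonneg _) (norm_geom_sum_le J ht) _

/-- Second moment of a block of frequencies `j ∈ [K, 2K)`. -/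
theorem integral_block_sq_le {ι : Type*} (P : Finset ι) (z : ι → ℝ) (c : ℕ → ℝ) {C : ℝ}
    (hc : ∀ j, 0 ≤ c j) (hC : ∀ j, c j ≤ C) (K H : ℕ) :
    ∫ α, ‖∑ p ∈ Finset.Ico K (2 * K) ×ˢ P, (c p.1 : ℂ) *
      Complex.exp (-(α * (2 * Real.pi * (p.1 * z p.2)) : ℝ) * Complex.I)‖ ^ 2 ∂(gaussianReal 0 1) ≤
    C ^ 2 * (∑ j ∈ Finset.Ico K (2 * K), ∑ l ∈ Finset.Ico K (2 * K),
      (((P ×ˢ P).filter fun r => |j * z r.1 - l * z r.2| ≤ H).card : ℝ) +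
        (K * P.card) ^ 2 * Real.exp (-(H : ℝ) ^ 2)) := by
  classical
  have hC0 : 0 ≤ C := (hc 0).trans (hC 0)
  rw [integral_norm_sq_exp_sum_gaussianReal (Finset.Ico K (2 * K) ×ˢ P) (fun p => c p.1)
    (fun p => 2 * Real.pi * (p.1 * z p.2))]
  -- Frequencies further apart than H give a Gaussian factor exp(-2π²(difference)²) ≤ exp(-H²);
  -- closer ones are simply counted.
  have hterm : ∀ p q : ℕ × ι, c p.1 * c q.1 * Real.exp (-(((1 : NNReal) : ℝ) *
      (2 * Real.pi * (p.1 * z p.2) - 2 * Real.pi * (q.1 * z q.2)) ^ 2) / 2) ≤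
      C ^ 2 * ((if |p.1 * z p.2 - q.1 * z q.2| ≤ H then 1 else 0) + Real.exp (-(H : ℝ) ^ 2)) := by
    intro p q
    have hcc : c p.1 * c q.1 ≤ C ^ 2 := by
      rw [pow_two]
      exact mul_le_mul (hC _) (hC _) (hc _) hC0
    refine mul_le_mul hcc ?_ (Real.exp_nonneg _) (sq_nonneg C)
    rw [NNReal.coe_one, one_mul, ← mul_sub]
    split_ifs with h
    · have : Real.exp (-(2 * Real.pi * (p.1 * z p.2 - q.1 * z q.2)) ^ 2 / 2) ≤ 1 :=
        Real.exp_le_one_iff.2 (by nlinarith [sq_nonneg (2 * Real.pi * (p.1 * z p.2 - q.1 * z q.2))])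
      linarith [Real.exp_nonneg (-(H : ℝ) ^ 2)]
    · rw [zero_add, Real.exp_le_exp]
      push Not at h
      have h1 : (H : ℝ) ^ 2 ≤ (p.1 * z p.2 - q.1 * z q.2) ^ 2 := by
        rw [← sq_abs (p.1 * z p.2 - q.1 * z q.2)]
        exact pow_le_pow_left₀ (Nat.cast_nonneg _) h.le 2
      rw [mul_pow]
      have h2 : (2 : ℝ) ≤ (2 * Real.pi) ^ 2 := by nlinarith [Real.pi_gt_three]
      nlinarith [sq_nonneg (p.1 * z p.2 - q.1 * z q.2)]
  refine (Finset.sum_le_sum fun p _ => Finset.sum_le_sum fun q _ => hterm p q).trans (le_of_eq ?_)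
  simp_rw [← Finset.mul_sum, Finset.sum_add_distrib]
  congr 2
  · rw [Finset.sum_product]
    refine Finset.sum_congr rfl fun j _ => ?_
    rw [Finset.sum_congr rfl fun p _ => Finset.sum_product _ _ _, Finset.sum_comm]
    refine Finset.sum_congr rfl fun l _ => ?_
    rw [Finset.card_filter, Finset.sum_product]
    push_cast
    rfl
  · simp only [Finset.sum_const, Finset.card_product, Nat.card_Ico, nsmul_eq_mul]
    rw [show 2 * K - K = K by omega]
    push_cast
    ring

theorem sum_Ico_one_two_pow (f : ℕ → ℝ) (n : ℕ) :
    ∑ j ∈ Finset.Ico 1 (2 ^ n), f j =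
      ∑ i ∈ Finset.range n, ∑ j ∈ Finset.Ico (2 ^ i : ℕ) (2 * 2 ^ i), f j := by
  induction n with
  | zero => simp
  | succ n ih =>
    rw [Finset.sum_range_succ, ← ih, ← pow_succ',
      Finset.sum_Ico_consecutive _ Nat.one_le_two_pow (Nat.pow_le_pow_right two_pos n.le_succ)]

/-- If the dilates `α z_p` avoid a `δ`-neighbourhood of the integers, then `α` lies in a set of
Gaussian measure controlled by the number of close pairs of multiples. -/
theorem measure_forall_le_distNearestInt_le {ι : Type*} (P : Finset ι) (hP : P.Nonempty)
    (z : ι → ℝ) {δ V : ℝ} {J r I H : ℕ} (hδ : 0 < δ) (hr : r * (J - 1) < 2 ^ I)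
    (hδJ : 2 * (2 : ℝ) ^ I ≤ (2 * δ * J) ^ (2 * r))
    (hV : ∀ i < I, ∑ j ∈ Finset.Ico (2 ^ i : ℕ) (2 * 2 ^ i), ∑ l ∈ Finset.Ico (2 ^ i : ℕ) (2 * 2 ^ i),
      (((P ×ˢ P).filter fun r => |j * z r.1 - l * z r.2| ≤ H).card : ℝ) +
        ((2 ^ i : ℕ) * P.card) ^ 2 * Real.exp (-(H : ℝ) ^ 2) ≤ V) :
    gaussianReal 0 1 {α | ∀ p ∈ P, δ ≤ distNearestInt (α * z p)} ≤
      ENNReal.ofReal (16 * I ^ 2 * V / P.card ^ 2) := by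
  obtain ⟨c, hc, hc2, hc0, hker⟩ := exists_cos_kernel (J := J) (r := r) (Nat.one_le_two_pow (n := I)) hr
  set R : ℝ := (P.card : ℝ) with hR
  have hR0 : 0 < R := Nat.cast_pos.2 hP.card_pos
  have hI0 : (0 : ℝ) < (2 : ℝ) ^ I := by positivity
  push_cast at hc0
  have hJpow : (2 * (2 : ℝ) ^ I) * (1 / (2 * δ)) ^ (2 * r) ≤ (J : ℝ) ^ (2 * r) := by
    rw [one_div, inv_pow, ← div_eq_mul_inv, div_le_iff₀ (by positivity), ← mul_pow]
    rwa [show (J : ℝ) * (2 * δ) = 2 * δ * J by ring]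
  -- At distance at least δ from the integers the kernel is at most half its constant term.
  have hhalf : (1 / (2 * δ)) ^ (2 * r) ≤ c 0 / 2 := by
    rw [div_le_iff₀ hI0] at hc0
    nlinarith
  have hc00 : 0 < c 0 := by
    have : 0 < (1 / (2 * δ)) ^ (2 * r) := by positivity
    linarith
  set B : ℕ → ℝ → ℂ := fun i α => ∑ p ∈ Finset.Ico (2 ^ i : ℕ) (2 * 2 ^ i) ×ˢ P, (c p.1 : ℂ) *
      Complex.exp (-(α * (2 * Real.pi * (p.1 * z p.2)) : ℝ) * Complex.I) with hB
  have hBre : ∀ i α, (B i α).re = ∑ j ∈ Finset.Ico (2 ^ i : ℕ) (2 * 2 ^ i), ∑ p ∈ P,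
      c j * Real.cos (2 * Real.pi * (α * z p) * j) := by
    intro i α
    simp only [hB]
    rw [Complex.re_sum, Finset.sum_product]
    refine Finset.sum_congr rfl fun j _ => Finset.sum_congr rfl fun p _ => ?_
    rw [Complex.re_ofReal_mul, ← Complex.ofReal_neg, Complex.exp_ofReal_mul_I_re, Real.cos_neg]
    congr 2
    ring
  set X : ℝ → ℝ := fun α => I * ∑ i ∈ Finset.range I, ‖B i α‖ ^ 2 with hX
  have hX0 : ∀ α, 0 ≤ X α := fun α => by positivity
  have hBi : ∀ i, Integrable (fun α => ‖B i α‖ ^ 2) (gaussianReal 0 1) := by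
    intro i
    have hcont : Continuous (B i) := by fun_prop
    refine integrable_of_norm_le_linear (hcont.norm.pow 2).aestronglyMeasurable
      ((∑ p ∈ Finset.Ico (2 ^ i : ℕ) (2 * 2 ^ i) ×ˢ P, c p.1) ^ 2) 0 fun α => ?_
    rw [Real.norm_of_nonneg (by positivity), zero_mul, add_zero]
    exact pow_le_pow_left₀ (norm_nonneg _) (norm_exp_sum_le _ (fun p _ => hc p.1) _ α) 2
  have hXi : Integrable X (gaussianReal 0 1) :=
    (integrable_finsetSum _ fun i _ => hBi i).const_mul _
  have hXint : ∫ α, X α ∂(gaussianReal 0 1) ≤ I ^ 2 * ((2 * c 0) ^ 2 * V) := by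
    simp only [hX]
    rw [integral_const_mul, integral_finsetSum _ fun i _ => hBi i]
    have h1 : ∀ i ∈ Finset.range I, ∫ α, ‖B i α‖ ^ 2 ∂(gaussianReal 0 1) ≤ (2 * c 0) ^ 2 * V := by
      intro i hi
      refine (integral_block_sq_le P z c hc hc2 (2 ^ i) H).trans ?_
      exact mul_le_mul_of_nonneg_left (hV i (Finset.mem_range.1 hi)) (sq_nonneg _)
    have h2 := Finset.sum_le_card_nsmul _ _ _ h1
    rw [Finset.card_range, nsmul_eq_mul] at h2
    calc _ ≤ (I : ℝ) * (I * ((2 * c 0) ^ 2 * V)) :=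
          mul_le_mul_of_nonneg_left h2 (Nat.cast_nonneg _)
      _ = _ := by ring
  -- If no dilate comes within δ, the nonconstant part of the kernel is at most -c 0 / 2 at each p,
  -- so Y² ≥ (c 0 R / 2)². Cauchy–Schwarz over the I dyadic blocks turns this into a lower bound for
  -- X; Chebyshev then gives 16 = 2²/(1/2)².
  have hsub : {α | ∀ p ∈ P, δ ≤ distNearestInt (α * z p)} ⊆ {α | (c 0 * R / 2) ^ 2 ≤ X α} := by
    intro α hα
    have hα : ∀ p ∈ P, δ ≤ distNearestInt (α * z p) := hα
    set Y := ∑ p ∈ P, ∑ j ∈ Finset.Ico 1 (2 ^ I), c j * Real.cos (2 * Real.pi * (α * z p) * j)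
      with hY
    have h1 : Y ≤ -(c 0 * R / 2) := by
      have h2 : ∀ p ∈ P, ∑ j ∈ Finset.Ico 1 (2 ^ I),
          c j * Real.cos (2 * Real.pi * (α * z p) * j) ≤ -(c 0 / 2) := by
        intro p hp
        have hd := hα p hp
        have h3 := hker (α * z p) (hδ.trans_le hd)
        rw [Finset.range_eq_Ico, Finset.sum_eq_sum_Ico_succ_bot (by positivity)] at h3
        have h4 : (1 / (2 * distNearestInt (α * z p))) ^ (2 * r) ≤ (1 / (2 * δ)) ^ (2 * r) := by
          refine pow_le_pow_left₀ (by have := hδ.trans_le hd; positivity) ?_ _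
          exact one_div_le_one_div_of_le (by linarith) (by linarith)
        simp only [Nat.cast_zero, mul_zero, Real.cos_zero, mul_one, zero_add] at h3
        linarith
      have h5 := Finset.sum_le_card_nsmul _ _ _ h2
      rw [nsmul_eq_mul] at h5
      linarith
    have h6 : Y = ∑ i ∈ Finset.range I, (B i α).re := by
      rw [hY, Finset.sum_comm, sum_Ico_one_two_pow]
      exact Finset.sum_congr rfl fun i _ => (hBre i α).symm
    have h7 : Y ^ 2 ≤ X α := by
      rw [h6]
      have h8 := sq_sum_le_card_mul_sum_sq (s := Finset.range I) (f := fun i => (B i α).re)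
      rw [Finset.card_range] at h8
      refine h8.trans (mul_le_mul_of_nonneg_left (Finset.sum_le_sum fun i _ => ?_)
        (Nat.cast_nonneg _))
      rw [← sq_abs]
      exact pow_le_pow_left₀ (abs_nonneg _) (Complex.abs_re_le_norm _) 2
    have h9 : 0 < c 0 * R / 2 := by positivity
    change (c 0 * R / 2) ^ 2 ≤ X α
    nlinarith
  have hcheb := mul_meas_ge_le_integral_of_nonneg (Eventually.of_forall hX0) hXi ((c 0 * R / 2) ^ 2)
  refine (measure_mono hsub).trans ?_
  rw [← ENNReal.ofReal_toReal (measure_ne_top (gaussianReal 0 1) _)]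
  refine ENNReal.ofReal_le_ofReal ?_
  have h10 : (c 0 * R / 2) ^ 2 * (gaussianReal 0 1).real {α | (c 0 * R / 2) ^ 2 ≤ X α} ≤
      I ^ 2 * ((2 * c 0) ^ 2 * V) := hcheb.trans hXint
  change (gaussianReal 0 1).real {α | (c 0 * R / 2) ^ 2 ≤ X α} ≤ _
  rw [← le_div_iff₀' (by positivity)] at h10
  refine h10.trans (le_of_eq ?_)
  field_simp
  ring

/-! ### Differences of the sequence and its additive energy -/

theorem strictMonoOn_of_gap {x : ℕ → ℝ} (hgap : ∃ c : ℝ, 0 < c ∧ ∀ n : ℕ, 1 ≤ n → c ≤ x (n + 1) - x n)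
    {m n : ℕ} (hn : 1 ≤ n) (hmn : n < m) : x n < x m := by
  obtain ⟨c, hc, h⟩ := hgap
  induction m, hmn using Nat.le_induction with
  | base => linarith [h n hn]
  | succ m hm ih => linarith [h m (by omega)]

section Pairs

open Classical

/-- The value of a pair of indices: the difference of the two terms. -/
noncomputable def pairDiff (x : ℕ → ℝ) (p : ℕ × ℕ) : ℝ := x p.1 - x p.2

/-- The pairs `n < m` of indices up to `N`. -/
noncomputable def orderedPairs (N : ℕ) : Finset (ℕ × ℕ) :=
  (Finset.Icc 1 N ×ˢ Finset.Icc 1 N).filter fun p => p.2 < p.1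

theorem closePairs_le_addEnergy (x : ℕ → ℝ) {N : ℕ} {P : Finset (ℕ × ℕ)}
    (hP : P ⊆ orderedPairs N) : closePairs P (pairDiff x) ≤ addEnergy x N := by
  unfold closePairs addEnergy addEnergyAt
  -- (x_a - x_b) - (x_c - x_d) = x_a + x_d - x_b - x_c, an injective relabelling into quadruples.
  refine Finset.card_le_card_of_injOn (fun r => (r.1.1, r.2.2, r.1.2, r.2.1)) ?_ ?_
  · rintro ⟨p, q⟩ h
    rw [Finset.mem_coe, Finset.mem_filter, Finset.mem_product] at h
    rw [Finset.mem_coe, Finset.mem_filter]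
    simp only [Finset.mem_product, pairDiff] at h ⊢
    have h1 := hP h.1.1
    have h2 := hP h.1.2
    simp only [orderedPairs, Finset.mem_filter, Finset.mem_product] at h1 h2
    refine ⟨⟨h1.1.1, h2.1.2, h1.1.2, h2.1.1⟩, ?_⟩
    rw [show x p.1 + x q.2 - x p.2 - x q.1 = x p.1 - x p.2 - (x q.1 - x q.2) by ring]
    exact h.2
  · rintro ⟨⟨a, b⟩, c, d⟩ _ ⟨⟨a', b'⟩, c', d'⟩ _ h
    simp only [Prod.mk.injEq] at h ⊢
    tauto

theorem card_orderedPairs_le (N : ℕ) : (orderedPairs N).card ≤ N ^ 2 := by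
  refine (Finset.card_filter_le _ _).trans (le_of_eq ?_)
  rw [Finset.card_product, Nat.card_Icc]
  simp [pow_two]

theorem sq_le_nine_mul_card_orderedPairs {N : ℕ} (hN : 2 ≤ N) :
    N ^ 2 ≤ 9 * (orderedPairs N).card := by
  -- Larger index in the upper half, smaller in the lower; the 9 comes from N ≤ 3⌊N/2⌋.
  have hsub : Finset.Ioc (N / 2) N ×ˢ Finset.Icc 1 (N / 2) ⊆ orderedPairs N := by
    rintro ⟨m, n⟩ h
    simp only [orderedPairs, Finset.mem_filter, Finset.mem_product, Finset.mem_Icc,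
      Finset.mem_Ioc] at h ⊢
    omega
  have h := Finset.card_le_card hsub
  rw [Finset.card_product, Nat.card_Ioc, Nat.card_Icc, Nat.add_sub_cancel] at h
  have h1 : N ≤ 3 * (N / 2) := by omega
  have h2 : N / 2 ≤ N - N / 2 := by omega
  nlinarith [Nat.mul_le_mul h2 (le_refl (N / 2))]

/-- Cauchy–Schwarz over the at most B + 1 unit cells meeting [0, B): many small differences would
force many close pairs. -/
theorem card_small_sq_le {ι : Type*} (A : Finset ι) (z : ι → ℝ) {B : ℝ}
    (hz : ∀ p ∈ A, 0 ≤ z p ∧ z p < B) : (A.card : ℝ) ^ 2 ≤ (B + 1) * closePairs A z := by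
  rcases A.eq_empty_or_nonempty with rfl | ⟨p₀, hp₀⟩
  · simp [closePairs]
  have hB : 0 < B := (hz p₀ hp₀).1.trans_lt (hz p₀ hp₀).2
  set U := Finset.Icc (0 : ℤ) ⌊B⌋ with hU
  have hmaps : ∀ p ∈ A, ⌊z p⌋ ∈ U := fun p hp =>
    Finset.mem_Icc.2 ⟨Int.floor_nonneg.2 (hz p hp).1, Int.floor_le_floor (hz p hp).2.le⟩
  have h1 := card_filter_eq_sum_mul A A (fun p => ⌊z p⌋) (fun p => ⌊z p⌋) hmaps
  have h2 : ((A ×ˢ A).filter fun r => ⌊z r.1⌋ = ⌊z r.2⌋).card ≤ closePairs A z :=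
    Finset.card_le_card (Finset.monotone_filter_right _ fun r _ hr =>
      Int.abs_sub_lt_one_of_floor_eq_floor hr)
  have h3 := sq_sum_le_card_mul_sum_sq (s := U)
    (f := fun n => ((A.filter fun p => ⌊z p⌋ = n).card : ℝ))
  have h4 : (A.card : ℝ) = ∑ n ∈ U, ((A.filter fun p => ⌊z p⌋ = n).card : ℝ) := by
    rw [Finset.card_eq_sum_card_fiberwise hmaps]
    push_cast
    rfl
  have h5 : ∑ n ∈ U, ((A.filter fun p => ⌊z p⌋ = n).card : ℝ) ^ 2 ≤ closePairs A z := by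
    simp_rw [pow_two]
    exact_mod_cast h1 ▸ h2
  have h6 : (U.card : ℝ) ≤ B + 1 := by
    rw [hU, Int.card_Icc, sub_zero]
    have h7 : 0 ≤ ⌊B⌋ := Int.floor_nonneg.2 hB.le
    have h8 : (((⌊B⌋ + 1).toNat : ℤ) : ℝ) = (⌊B⌋ : ℝ) + 1 := by
      rw [Int.toNat_of_nonneg (by omega)]; push_cast; rfl
    rw [Int.cast_natCast] at h8
    rw [h8]
    linarith [Int.floor_le B]
  rw [h4]
  exact h3.trans (mul_le_mul h6 h5 (Finset.sum_nonneg fun _ _ => sq_nonneg _) (by linarith))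

/-- The pairs of indices up to `N` whose difference is at least `B`. -/
noncomputable def farPairs (x : ℕ → ℝ) (N : ℕ) (B : ℝ) : Finset (ℕ × ℕ) :=
  (orderedPairs N).filter fun p => B ≤ pairDiff x p

/-- Of at least N²/9 pairs, low energy allows at most N²/18 to have difference below B. -/
theorem sq_le_card_farPairs {x : ℕ → ℝ}
    (hgap : ∃ c : ℝ, 0 < c ∧ ∀ n : ℕ, 1 ≤ n → c ≤ x (n + 1) - x n) {N : ℕ} (hN : 2 ≤ N) {B : ℝ}
    (hB : 0 < B) (hE : (B + 1) * addEnergy x N ≤ ((N : ℝ) ^ 2 / 18) ^ 2) :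
    (N : ℝ) ^ 2 / 18 ≤ (farPairs x N B).card := by
  have hsplit := Finset.card_filter_add_card_filter_not (s := orderedPairs N)
    (fun p => B ≤ pairDiff x p)
  set A := (orderedPairs N).filter fun p => ¬ B ≤ pairDiff x p with hA
  have h1 : (A.card : ℝ) ^ 2 ≤ ((N : ℝ) ^ 2 / 18) ^ 2 := by
    refine (card_small_sq_le A (pairDiff x) (B := B) fun p hp => ?_).trans
      ((mul_le_mul_of_nonneg_left ?_ (by linarith)).trans hE)
    · rw [hA, Finset.mem_filter, not_le] at hp
      refine ⟨?_, hp.2⟩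
      have h := hp.1
      simp only [orderedPairs, Finset.mem_filter, Finset.mem_product, Finset.mem_Icc] at h
      exact (sub_pos.2 (strictMonoOn_of_gap hgap h.1.2.1 h.2)).le
    · exact_mod_cast closePairs_le_addEnergy x (Finset.filter_subset _ _)
  have h2 : (A.card : ℝ) ≤ (N : ℝ) ^ 2 / 18 := by
    exact le_of_sq_le_sq h1 (by positivity)
  have h3 : (N : ℝ) ^ 2 ≤ 9 * ((orderedPairs N).card : ℝ) := by
    exact_mod_cast sq_le_nine_mul_card_orderedPairs hN
  have h4 : ((farPairs x N B).card : ℝ) + A.card = (orderedPairs N).card := by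
    exact_mod_cast hsplit
  linarith

theorem metricMinGap_le {x : ℕ → ℝ} {N : ℕ} (hN : 2 ≤ N) {B : ℝ} {p : ℕ × ℕ}
    (hp : p ∈ farPairs x N B) (α : ℝ) :
    metricMinGap x α N ≤ distNearestInt (α * pairDiff x p) := by
  simp only [farPairs, orderedPairs, Finset.mem_filter, Finset.mem_product] at hp
  refine (minGap_isLeast (fun n => α * x n) hN).2 ⟨p.1, hp.1.1.1, p.2, hp.1.1.2, hp.1.2.ne', ?_⟩
  rw [pairDiff, mul_sub]

/-- The counting estimate for close dilates, with parameters given as powers of `X`. -/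
theorem exists_sum_card_dilate_le {κ m ε : ℝ} (hκ : 2 ≤ κ) (hm : 0 ≤ m) (hε : 0 < ε)
    (hζ : ZetaMomentBound κ m) :
    ∃ C T₀ : ℝ, 0 < C ∧ ∀ {ι : Type} (P : Finset ι) (z : ι → ℝ) (X a : ℝ) (K H : ℕ),
      1 ≤ X → T₀ ≤ X ^ ε → 0 ≤ a → 1 ≤ K → (K : ℝ) ≤ X ^ a → 1 ≤ H → (H : ℝ) ≤ X ^ ε →
      (P.card : ℝ) ≤ X ^ (2 : ℝ) → (closePairs P z : ℝ) ≤ X ^ (2 + ε) →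
      (∀ p ∈ P, X ^ (a + 2 * ε) ≤ z p) →
      a + (2 - a - 2 * ε) * (1 - κ / 2) + (2 * a + ε) * (m + ε) ≤ -ε →
      ∑ j ∈ Finset.Ico K (2 * K), ∑ l ∈ Finset.Ico K (2 * K),
        (((P ×ˢ P).filter fun r => |j * z r.1 - l * z r.2| ≤ H).card : ℝ) ≤
        C * H * X ^ (4 - ε) := by
  obtain ⟨C₁, T₀, hC₁, hT₀, hM⟩ := hζ.exists_gaussianMoment_le (by linarith) hε
  obtain ⟨D, hD, hform⟩ := exists_logForm_le
  refine ⟨9 * Real.exp 2 * (D * (2 + C₁)), T₀, by positivity, ?_⟩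
  intro ι P z X a K H hX hXT ha hK hKa hH hHε hP hclose hz hexp
  have hX0 : 0 < X := by linarith
  have hK1 : (1 : ℝ) ≤ K := by exact_mod_cast hK
  have hK0 : (0 : ℝ) < K := by linarith
  -- Just above K², so that the pole term saves X^ε, while T H ≤ K B still holds because all
  -- differences are at least X^(a + 2ε).
  set T : ℝ := K ^ 2 * X ^ ε with hT
  have hT0 : 0 < T := by positivity
  have hXε : 0 < X ^ ε := by positivity
  have hTT : T₀ ≤ T := hXT.trans (by rw [hT]; nlinarith [one_le_pow₀ hK1 (n := 2)])
  have hTB : T * H ≤ K * X ^ (a + 2 * ε) := by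
    have h1 : X ^ (a + 2 * ε) = X ^ a * (X ^ ε * X ^ ε) := by
      rw [← Real.rpow_add hX0, ← Real.rpow_add hX0]; congr 1; ring
    rw [h1, hT]
    have h2 : X ^ ε * H ≤ X ^ ε * X ^ ε := mul_le_mul_of_nonneg_left hHε hXε.le
    have h3 : K * (X ^ ε * H) ≤ X ^ a * (X ^ ε * X ^ ε) :=
      mul_le_mul hKa h2 (by positivity) (by positivity)
    nlinarith
  obtain ⟨S, v, hv, hv1, hv2, hcount⟩ := exists_window_weights P hT0
    (Real.rpow_pos_of_pos hX0 (a + 2 * ε)) hK hH hTB hz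
  refine hcount.trans ?_
  -- The level at which the mean-square term K L W is at most X^(4-ε).
  set L : ℝ := X ^ (2 - a - 2 * ε) with hL
  have hL0 : 0 < L := by positivity
  have hf := hform κ T L K S v hκ hT0 hL0 hK hv
  set V := ∑ k ∈ S, v k
  set W := ∑ k ∈ S, v k ^ 2
  have hV0 : 0 ≤ V := Finset.sum_nonneg fun k _ => hv k
  have hW0 : 0 ≤ W := Finset.sum_nonneg fun k _ => sq_nonneg _
  have hV2 : V ^ 2 ≤ X ^ (4 : ℝ) := by
    have := pow_le_pow_left₀ hV0 (hv1.trans hP) 2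
    rwa [← Real.rpow_natCast (X ^ (2 : ℝ)), ← Real.rpow_mul hX0.le,
      show (2 : ℝ) * (2 : ℕ) = 4 by norm_num] at this
  have hW2 : W ≤ X ^ (2 + ε) := hv2.trans hclose
  have ht1 : (K : ℝ) ^ 2 * V ^ 2 / T ≤ X ^ (4 - ε) := by
    rw [hT, mul_div_mul_left _ _ (by positivity), div_le_iff₀ hXε, ← Real.rpow_add hX0]
    simpa using hV2
  have ht2 : K * (L * W) ≤ X ^ (4 - ε) := by
    have h1 : X ^ (4 - ε) = X ^ a * (L * X ^ (2 + ε)) := by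
      rw [hL, ← Real.rpow_add hX0, ← Real.rpow_add hX0]; congr 1; ring
    rw [h1]
    exact mul_le_mul hKa (mul_le_mul_of_nonneg_left hW2 hL0.le) (by positivity) (by positivity)
  -- The large-value term; its exponent beyond 4 is exactly the left side of `hexp`.
  have ht3 : K * (L ^ (1 - κ / 2) * (V ^ 2 * gaussianMoment κ T)) ≤ C₁ * X ^ (4 - ε) := by
    have hTX : T ≤ X ^ (2 * a + ε) := by
      rw [Real.rpow_add hX0, hT]
      refine mul_le_mul_of_nonneg_right ?_ hXε.le
      have := pow_le_pow_left₀ hK0.le hKa 2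
      rwa [← Real.rpow_natCast (X ^ a), ← Real.rpow_mul hX0.le, mul_comm a,
        show ((2 : ℕ) : ℝ) = 2 by norm_num] at this
    have hMT : gaussianMoment κ T ≤ C₁ * X ^ ((2 * a + ε) * (m + ε)) := by
      refine (hM T hTT).trans (mul_le_mul_of_nonneg_left ?_ hC₁.le)
      rw [Real.rpow_mul hX0.le]
      exact Real.rpow_le_rpow hT0.le hTX (by linarith)
    have hM0 : 0 ≤ gaussianMoment κ T := integral_nonneg fun u => by positivity
    have hLp : L ^ (1 - κ / 2) = X ^ ((2 - a - 2 * ε) * (1 - κ / 2)) := by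
      rw [hL, ← Real.rpow_mul hX0.le]
    calc K * (L ^ (1 - κ / 2) * (V ^ 2 * gaussianMoment κ T))
        ≤ X ^ a * (L ^ (1 - κ / 2) * (X ^ (4 : ℝ) * (C₁ * X ^ ((2 * a + ε) * (m + ε))))) := by
          gcongr
      _ = C₁ * X ^ (4 + (a + (2 - a - 2 * ε) * (1 - κ / 2) + (2 * a + ε) * (m + ε))) := by
          rw [hLp, Real.rpow_add hX0, Real.rpow_add hX0, Real.rpow_add hX0]; ring
      _ ≤ C₁ * X ^ (4 - ε) := by
          refine mul_le_mul_of_nonneg_left ?_ hC₁.le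
          exact Real.rpow_le_rpow_of_exponent_le hX (by linarith)
  have hF : logForm T K S v ≤ D * ((2 + C₁) * X ^ (4 - ε)) :=
    hf.trans (mul_le_mul_of_nonneg_left (by linarith) hD.le)
  calc 9 * H * Real.exp 2 * logForm T K S v
      ≤ 9 * H * Real.exp 2 * (D * ((2 + C₁) * X ^ (4 - ε))) :=
        mul_le_mul_of_nonneg_left hF (by positivity)
    _ = _ := by ring

end Pairs

/-! ### Choice of exponents and the measure of the exceptional set -/

theorem eventually_const_mul_rpow_le (C : ℝ) {p q : ℝ} (h : p < q) :
    ∀ᶠ X : ℝ in atTop, C * X ^ p ≤ X ^ q := by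
  filter_upwards [(tendsto_rpow_atTop (sub_pos.2 h)).eventually_ge_atTop C, eventually_gt_atTop 0]
    with X h1 h2
  have h3 : X ^ q = X ^ (q - p) * X ^ p := by
    rw [← Real.rpow_add h2]; congr 1; ring
  rw [h3]
  exact mul_le_mul_of_nonneg_right h1 (by positivity)

theorem eventually_rpow_mul_exp_neg_le (p : ℝ) {q : ℝ} (hq : 0 < q) :
    ∀ᶠ X : ℝ in atTop, X ^ p * Real.exp (-X ^ q) ≤ 1 := by
  have h := (tendsto_rpow_mul_exp_neg_mul_atTop_nhds_zero (p / q) 1 one_pos).comp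
    (tendsto_rpow_atTop hq)
  filter_upwards [h.eventually_le_const (zero_lt_one' ℝ), eventually_gt_atTop 0] with X h1 h2
  simp only [Function.comp_apply, neg_mul, one_mul] at h1
  rwa [← Real.rpow_mul h2.le, mul_div_cancel₀ _ hq.ne'] at h1

/-- At ε = 0 the last inequality, made strict, is the hypothesis a(κ/2 + 2m) < κ - 2; continuity in
ε does the rest. -/
theorem exists_small_exponent {κ m a : ℝ} (h : a * (κ / 2 + 2 * m) < κ - 2) (ha : a < 2) :
    ∃ ε : ℝ, 0 < ε ∧ a + 3 * ε < 2 ∧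
      a + (2 - a - 2 * ε) * (1 - κ / 2) + (2 * a + ε) * (m + ε) ≤ -ε := by
  have h1 : ∀ᶠ ε : ℝ in 𝓝 0, a + 3 * ε < 2 :=
    ContinuousAt.eventually_lt (by fun_prop) continuousAt_const (by simpa using ha)
  have h2 : ∀ᶠ ε : ℝ in 𝓝 0,
      a + (2 - a - 2 * ε) * (1 - κ / 2) + (2 * a + ε) * (m + ε) < -ε :=
    ContinuousAt.eventually_lt (by fun_prop) (by fun_prop) (by simp; linarith)
  have h3 : ∀ᶠ ε : ℝ in 𝓝[>] 0, 0 < ε := eventually_mem_nhdsWithin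
  have h4 : ∀ᶠ ε : ℝ in 𝓝[>] 0, a + 3 * ε < 2 ∧
      a + (2 - a - 2 * ε) * (1 - κ / 2) + (2 * a + ε) * (m + ε) < -ε :=
    (h1.and h2).filter_mono nhdsWithin_le_nhds
  obtain ⟨ε, ⟨e1, e2⟩, e3⟩ := (h4.and h3).exists
  exact ⟨ε, e3, e1, e2.le⟩

set_option maxHeartbeats 1000000 in
/-- Measure bound for the set of `α` without a small gap among the first `X = 2 ^ l` terms. -/
theorem eventually_measure_no_small_gap_le {x : ℕ → ℝ}
    (hgap : ∃ c : ℝ, 0 < c ∧ ∀ n : ℕ, 1 ≤ n → c ≤ x (n + 1) - x n)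
    (henergy : ∃ o : ℕ → ℝ, Tendsto o atTop (𝓝 0) ∧
      ∀ᶠ N : ℕ in atTop, (addEnergy x N : ℝ) = (N : ℝ) ^ (2 + o N))
    {κ m : ℝ} (hκ : 2 < κ) (hζ : ZetaMomentBound κ m) {η : ℝ} (hη : 0 < η)
    (hηe : η < (2 * κ - 4) / (κ + 4 * m)) :
    ∃ (D θ : ℝ) (B : ℕ → ℝ), 0 < θ ∧ ∀ᶠ l : ℕ in atTop,
      gaussianReal 0 1 {α | ∀ p ∈ farPairs x (2 ^ l) (B l),
        ((2 : ℝ) ^ l) ^ (-((2 * κ - 4) / (κ + 4 * m) - η)) ≤ distNearestInt (α * pairDiff x p)} ≤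
      ENNReal.ofReal (D * ((l : ℝ) ^ 2 * ((2 : ℝ) ^ (-θ)) ^ l)) := by
  have hm : 0 ≤ m := hζ.nonneg hκ.le
  have hden : 0 < κ + 4 * m := by linarith
  set e := (2 * κ - 4) / (κ + 4 * m) with he
  have hemul : e * (κ + 4 * m) = 2 * κ - 4 := div_mul_cancel₀ _ hden.ne'
  have he2 : e < 2 := by rw [he, div_lt_iff₀ hden]; linarith
  -- The degree X^a exceeds 1/δ = X^(e - η) by X^(η/2), the room needed for the kernel to decay,
  -- while a < e keeps the count under control.
  set a := e - η / 2 with ha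
  have ha0 : 0 < a := by linarith
  have ha2 : a < 2 := by linarith
  obtain ⟨ε, hε, haε, hexp⟩ := exists_small_exponent (κ := κ) (m := m) (a := a)
    (by nlinarith) ha2
  obtain ⟨C, T₀, hC, hcount⟩ := exists_sum_card_dilate_le hκ.le hm hε hζ
  obtain ⟨s, hs⟩ := pow_unbounded_of_one_lt (2 / η) (one_lt_two : (1 : ℝ) < 2)
  -- A power of two, so that r · 2^(I-s) = 2^I exactly, and large enough that (X^(η/2))^(2r)
  -- outgrows X^a.
  set r : ℕ := 2 ^ s with hr
  have hrη : a < η * r := by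
    rw [div_lt_iff₀ hη] at hs
    rw [hr]; push_cast; linarith
  have hr0 : (0 : ℝ) < r := by rw [hr]; positivity
  refine ⟨16 * 4 * (2 * C + 1) * 18 ^ 2, 3 * ε / 4, fun l => ((2 : ℝ) ^ l) ^ (a + 2 * ε),
    by positivity, ?_⟩
  have hXt : Tendsto (fun l : ℕ => (2 : ℝ) ^ l) atTop atTop :=
    tendsto_pow_atTop_atTop_of_one_lt one_lt_two
  have hNt : Tendsto (fun l : ℕ => 2 ^ l) atTop (atTop : Filter ℕ) :=
    tendsto_pow_atTop_atTop_of_one_lt one_lt_two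
  have hE1 := hXt.eventually ((tendsto_rpow_atTop hε).eventually_ge_atTop T₀)
  have hE2 : ∀ᶠ l : ℕ in atTop, (addEnergy x (2 ^ l) : ℝ) ≤ ((2 : ℝ) ^ l) ^ (2 + ε) := by
    obtain ⟨o, ho, hoE⟩ := henergy
    have h1 := hNt.eventually (hoE.and (ho.eventually_le_const hε))
    filter_upwards [h1] with l h2
    rw [h2.1]
    push_cast
    exact Real.rpow_le_rpow_of_exponent_le (one_le_pow₀ one_le_two) (by linarith [h2.2])
  have hE3 := hXt.eventually (eventually_const_mul_rpow_le (2 * 18 ^ 2)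
    (show (a + 2 * ε) + (2 + ε) < 4 by linarith))
  have hE4 := hXt.eventually (eventually_const_mul_rpow_le (2 * (r : ℝ) ^ (2 * r)) hrη)
  have hE5 := hXt.eventually (eventually_const_mul_rpow_le 2 (show ε / 4 < ε by linarith))
  have hE6 := hXt.eventually (eventually_rpow_mul_exp_neg_le (2 * a + 3 * ε / 4)
    (show 0 < ε / 2 by linarith))
  have hE7 : ∀ᶠ l : ℕ in atTop, s ≤ ⌊a * l⌋₊ :=
    ((tendsto_nat_floor_atTop (α := ℝ)).comp
      (tendsto_natCast_atTop_atTop.const_mul_atTop ha0)).eventually_ge_atTop s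
  filter_upwards [hE1, hE2, hE3, hE4, hE5, hE6, hE7, eventually_ge_atTop 1] with
    l e1 e2 e3 e4 e5 e6 e7 e8
  set X : ℝ := (2 : ℝ) ^ l with hX
  have hX1 : 1 ≤ X := one_le_pow₀ one_le_two
  have hX0 : 0 < X := by linarith
  set I : ℕ := ⌊a * l⌋₊ with hI
  have hal0 : 0 ≤ a * l := by positivity
  have hXa : X ^ a = (2 : ℝ) ^ (a * l) := by
    rw [hX, ← Real.rpow_natCast, ← Real.rpow_mul two_pos.le, mul_comm]
  have hIX : (2 : ℝ) ^ I ≤ X ^ a := by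
    rw [hXa, ← Real.rpow_natCast]
    exact Real.rpow_le_rpow_of_exponent_le one_le_two (Nat.floor_le hal0)
  have hXI : X ^ a ≤ 2 * (2 : ℝ) ^ I := by
    rw [hXa, ← pow_succ', ← Real.rpow_natCast]
    refine Real.rpow_le_rpow_of_exponent_le one_le_two ?_
    push_cast
    exact (Nat.lt_floor_add_one _).le
  have hIl : (I : ℝ) ≤ 2 * l := by
    refine (Nat.floor_le hal0).trans ?_
    exact mul_le_mul_of_nonneg_right ha2.le (Nat.cast_nonneg _)
  set B := X ^ (a + 2 * ε) with hB
  have hB1 : 1 ≤ B := Real.one_le_rpow hX1 (by linarith)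
  set P := farPairs x (2 ^ l) B with hP
  have hPsub : P ⊆ orderedPairs (2 ^ l) := Finset.filter_subset _ _
  have hPcard : X ^ 2 / 18 ≤ P.card := by
    have h := sq_le_card_farPairs hgap (N := 2 ^ l) (B := B)
      (by calc 2 = 2 ^ 1 := rfl
            _ ≤ 2 ^ l := Nat.pow_le_pow_right two_pos e8) (by linarith) ?_
    · push_cast at h
      exact h
    · push_cast
      rw [← hX]
      have h1 : (B + 1) * (addEnergy x (2 ^ l) : ℝ) ≤ (2 * B) * X ^ (2 + ε) :=
        mul_le_mul (by linarith) e2 (Nat.cast_nonneg _) (by linarith)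
      rw [Real.rpow_add hX0] at e3
      have h2 : X ^ (4 : ℝ) = (X ^ 2) ^ 2 := by
        rw [← pow_mul, ← Real.rpow_natCast]; norm_num
      rw [h2] at e3
      refine h1.trans ?_
      rw [div_pow, le_div_iff₀ (by norm_num)]
      linarith
  have hPne : P.Nonempty := by
    rw [← Finset.card_pos]
    have : 0 < X ^ 2 / 18 := by positivity
    exact_mod_cast this.trans_le hPcard
  have hPle : (P.card : ℝ) ≤ X ^ (2 : ℝ) := by
    have h1 : (P.card : ℝ) ≤ ((2 ^ l) ^ 2 : ℕ) :=
      Nat.cast_le.2 ((Finset.card_le_card hPsub).trans (card_orderedPairs_le _))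
    push_cast at h1
    rwa [Real.rpow_two]
  have hPclose : (closePairs P (pairDiff x) : ℝ) ≤ X ^ (2 + ε) :=
    (Nat.cast_le.2 (closePairs_le_addEnergy x hPsub)).trans e2
  -- Makes exp(-H²) smaller than any power of X, at the cost of X^(ε/4) out of the saving X^ε; what
  -- remains is 3ε/4.
  set H : ℕ := ⌈X ^ (ε / 4)⌉₊ with hH
  have hXε4 : 1 ≤ X ^ (ε / 4) := Real.one_le_rpow hX1 (by linarith)
  have hH2 : (H : ℝ) ≤ 2 * X ^ (ε / 4) := by
    have := Nat.ceil_lt_add_one (show 0 ≤ X ^ (ε / 4) by linarith)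
    linarith
  have hH1 : 1 ≤ H := Nat.one_le_ceil_iff.2 (by linarith)
  have hHsq : X ^ (ε / 2) ≤ (H : ℝ) ^ 2 := by
    have h1 := pow_le_pow_left₀ (by linarith) (Nat.le_ceil (X ^ (ε / 4))) 2
    rw [← Real.rpow_natCast (X ^ (ε / 4)), ← Real.rpow_mul hX0.le] at h1
    refine le_trans (le_of_eq ?_) h1
    congr 1
    push_cast
    ring
  set V := (2 * C + 1) * X ^ (4 - 3 * ε / 4) with hV
  set δ := X ^ (-(e - η)) with hδ
  have hδ0 : 0 < δ := by positivity
  have hmain := measure_forall_le_distNearestInt_le P hPne (pairDiff x) (δ := δ) (V := V)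
    (J := 2 ^ (I - s)) (r := r) (I := I) (H := H) hδ0 ?_ ?_ ?_
  · refine hmain.trans (ENNReal.ofReal_le_ofReal ?_)
    have hX4 : X ^ (4 - 3 * ε / 4) = (X ^ 2) ^ 2 * X ^ (-(3 * ε / 4)) := by
      rw [sub_eq_add_neg, Real.rpow_add hX0, ← pow_mul, ← Real.rpow_natCast X]; norm_num
    have hθ : ((2 : ℝ) ^ (-(3 * ε / 4))) ^ l = X ^ (-(3 * ε / 4)) := by
      rw [hX, ← Real.rpow_natCast, ← Real.rpow_natCast, ← Real.rpow_mul two_pos.le,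
        ← Real.rpow_mul two_pos.le, mul_comm]
    rw [hθ, hV, hX4]
    have hsq : (X ^ 2 / 18) ^ 2 ≤ (P.card : ℝ) ^ 2 := pow_le_pow_left₀ (by positivity) hPcard 2
    have hIsq : (I : ℝ) ^ 2 ≤ 4 * (l : ℝ) ^ 2 := by
      have := pow_le_pow_left₀ (Nat.cast_nonneg I) hIl 2
      linarith
    have hy : 0 < X ^ (-(3 * ε / 4)) := by positivity
    rw [div_le_iff₀ (by have := hPne.card_pos; positivity)]
    calc 16 * (I : ℝ) ^ 2 * ((2 * C + 1) * ((X ^ 2) ^ 2 * X ^ (-(3 * ε / 4))))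
        ≤ 16 * (4 * (l : ℝ) ^ 2) * ((2 * C + 1) * ((X ^ 2) ^ 2 * X ^ (-(3 * ε / 4)))) := by
          gcongr
      _ = 16 * 4 * (2 * C + 1) * 18 ^ 2 * ((l : ℝ) ^ 2 * X ^ (-(3 * ε / 4))) *
            (X ^ 2 / 18) ^ 2 := by ring
      _ ≤ _ := by gcongr
  · have h1 : 2 ^ s * 2 ^ (I - s) = 2 ^ I := by rw [← pow_add]; congr 1; omega
    have h2 : 0 < 2 ^ (I - s) := by positivity
    have h3 : 0 < r := by rw [hr]; positivity
    calc r * (2 ^ (I - s) - 1) < r * 2 ^ (I - s) := Nat.mul_lt_mul_of_pos_left (by omega) h3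
      _ = 2 ^ I := h1
  · have h1 : (r : ℝ) * ((2 ^ (I - s) : ℕ) : ℝ) = 2 ^ I := by
      rw [hr]; push_cast; rw [← pow_add]; congr 1; omega
    have h2 : X ^ (η / 2) / r ≤ 2 * δ * ((2 ^ (I - s) : ℕ) : ℝ) := by
      rw [div_le_iff₀ hr0]
      have h3 : X ^ (η / 2) = δ * X ^ a := by
        rw [hδ, ← Real.rpow_add hX0]; congr 1; rw [ha]; ring
      rw [h3]
      calc δ * X ^ a ≤ δ * (2 * 2 ^ I) := mul_le_mul_of_nonneg_left hXI hδ0.le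
        _ = _ := by rw [← h1]; ring
    have h4 := pow_le_pow_left₀ (by positivity) h2 (2 * r)
    refine le_trans ?_ h4
    rw [div_pow, le_div_iff₀ (by positivity), ← Real.rpow_natCast (X ^ (η / 2)),
      ← Real.rpow_mul hX0.le]
    have h5 : η / 2 * ((2 * r : ℕ) : ℝ) = η * r := by push_cast; ring
    rw [h5]
    refine le_trans ?_ e4
    have h6 : (0 : ℝ) ≤ 2 * (r : ℝ) ^ (2 * r) := by positivity
    refine le_trans (le_of_eq ?_) (mul_le_mul_of_nonneg_left hIX h6)
    ring
  · intro i hi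
    have hKa : ((2 ^ i : ℕ) : ℝ) ≤ X ^ a := by
      refine le_trans ?_ hIX
      push_cast
      exact pow_le_pow_right₀ one_le_two hi.le
    have h1 := hcount P (pairDiff x) X a (2 ^ i) H hX1 e1 ha0.le Nat.one_le_two_pow hKa hH1
      (hH2.trans e5) hPle hPclose (fun p hp => (Finset.mem_filter.1 hp).2) hexp
    have h2 : C * H * X ^ (4 - ε) ≤ 2 * C * X ^ (4 - 3 * ε / 4) := by
      have h3 : X ^ (4 - 3 * ε / 4) = X ^ (ε / 4) * X ^ (4 - ε) := by
        rw [← Real.rpow_add hX0]; congr 1; ring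
      rw [h3]
      calc C * H * X ^ (4 - ε) ≤ C * (2 * X ^ (ε / 4)) * X ^ (4 - ε) := by gcongr
        _ = _ := by ring
    have h4 : (((2 ^ i : ℕ) : ℝ) * P.card) ^ 2 * Real.exp (-(H : ℝ) ^ 2) ≤ X ^ (4 - 3 * ε / 4) := by
      have h5 : (((2 ^ i : ℕ) : ℝ) * P.card) ^ 2 ≤ X ^ (2 * a + 4) := by
        have h6 := pow_le_pow_left₀ (by positivity) (mul_le_mul hKa hPle (Nat.cast_nonneg _)
          (by positivity)) 2
        rw [← Real.rpow_add hX0, ← Real.rpow_natCast (X ^ (a + 2)), ← Real.rpow_mul hX0.le] at h6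
        refine h6.trans (le_of_eq ?_)
        congr 1
        push_cast
        ring
      have h7 : Real.exp (-(H : ℝ) ^ 2) ≤ Real.exp (-X ^ (ε / 2)) :=
        Real.exp_le_exp.2 (neg_le_neg hHsq)
      have h8 : X ^ (2 * a + 4) = X ^ (4 - 3 * ε / 4) * X ^ (2 * a + 3 * ε / 4) := by
        rw [← Real.rpow_add hX0]; congr 1; ring
      calc _ ≤ X ^ (2 * a + 4) * Real.exp (-X ^ (ε / 2)) := by gcongr
        _ = X ^ (4 - 3 * ε / 4) * (X ^ (2 * a + 3 * ε / 4) * Real.exp (-X ^ (ε / 2))) := by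
          rw [h8, mul_assoc]
        _ ≤ X ^ (4 - 3 * ε / 4) * 1 := by gcongr
        _ = _ := mul_one _
    rw [hV]
    linarith

/-! ### Borel–Cantelli and passage to all N -/

theorem ae_eventually_metricMinGap_two_pow_lt {x : ℕ → ℝ}
    (hgap : ∃ c : ℝ, 0 < c ∧ ∀ n : ℕ, 1 ≤ n → c ≤ x (n + 1) - x n)
    (henergy : ∃ o : ℕ → ℝ, Tendsto o atTop (𝓝 0) ∧
      ∀ᶠ N : ℕ in atTop, (addEnergy x N : ℝ) = (N : ℝ) ^ (2 + o N))
    {κ m : ℝ} (hκ : 2 < κ) (hζ : ZetaMomentBound κ m) {η : ℝ} (hη : 0 < η)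
    (hηe : η < (2 * κ - 4) / (κ + 4 * m)) :
    ∀ᵐ α : ℝ ∂volume, ∀ᶠ l : ℕ in atTop,
      metricMinGap x α (2 ^ l) < ((2 : ℝ) ^ l) ^ (-((2 * κ - 4) / (κ + 4 * m) - η)) := by
  obtain ⟨D, θ, B, hθ, hev⟩ := eventually_measure_no_small_gap_le hgap henergy hκ hζ hη hηe
  obtain ⟨l₀, hl₀⟩ := eventually_atTop.1 hev
  set bad : ℕ → Set ℝ := fun l => {α | ∀ p ∈ farPairs x (2 ^ l) (B l),
    ((2 : ℝ) ^ l) ^ (-((2 * κ - 4) / (κ + 4 * m) - η)) ≤ distNearestInt (α * pairDiff x p)} with hbad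
  have hsum : Summable fun l : ℕ => D * ((l : ℝ) ^ 2 * ((2 : ℝ) ^ (-θ)) ^ l) := by
    refine (summable_pow_mul_geometric_of_norm_lt_one 2 ?_).mul_left D
    rw [Real.norm_of_nonneg (by positivity)]
    exact Real.rpow_lt_one_of_one_lt_of_neg one_lt_two (by linarith)
  have hfin : ∑' l : ℕ, gaussianReal 0 1 (bad (l + l₀)) ≠ ⊤ := by
    refine ne_top_of_le_ne_top ((summable_nat_add_iff l₀).2 hsum).tsum_ofReal_ne_top ?_
    exact ENNReal.tsum_le_tsum fun l => hl₀ (l + l₀) (Nat.le_add_left _ _)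
  have hbc := ae_eventually_notMem hfin
  -- Lebesgue measure is absolutely continuous with respect to the Gaussian, so Gaussian-null
  -- exceptional sets are Lebesgue-null.
  have hbc' := (gaussianReal_absolutelyContinuous' 0 one_ne_zero).ae_le hbc
  filter_upwards [hbc'] with α hα
  obtain ⟨l₁, hl₁⟩ := eventually_atTop.1 hα
  filter_upwards [eventually_ge_atTop (l₁ + l₀ + 1)] with l hl
  have h1 := hl₁ (l - l₀) (by omega)
  rw [Nat.sub_add_cancel (by omega)] at h1
  simp only [hbad, Set.mem_ofPred_eq, not_forall, not_le] at h1
  obtain ⟨p, hp, hlt⟩ := h1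
  refine (metricMinGap_le ?_ hp α).trans_lt hlt
  calc 2 = 2 ^ 1 := rfl
    _ ≤ 2 ^ l := Nat.pow_le_pow_right two_pos (by omega)

theorem metricMinGap_anti {x : ℕ → ℝ} {α : ℝ} {M N : ℕ} (hM : 2 ≤ M) (hMN : M ≤ N) :
    metricMinGap x α N ≤ metricMinGap x α M := by
  have hN := minGap_isLeast (fun n => α * x n) (hM.trans hMN)
  obtain ⟨m, hm, n, hn, hmn, h⟩ := (minGap_isLeast (fun n => α * x n) hM).1
  refine hN.2 ⟨m, ?_, n, ?_, hmn, h⟩ <;> rw [Finset.mem_Icc] at * <;> omega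

theorem metricMinGap_nonneg (x : ℕ → ℝ) (α : ℝ) {N : ℕ} (hN : 2 ≤ N) :
    0 ≤ metricMinGap x α N := by
  obtain ⟨m, _, n, _, _, h⟩ := (minGap_isLeast (fun n => α * x n) hN).1
  rw [metricMinGap, h]
  exact abs_nonneg _

theorem metricMinGap_le_half (x : ℕ → ℝ) (α : ℝ) {N : ℕ} (hN : 2 ≤ N) :
    metricMinGap x α N ≤ 1 / 2 := by
  obtain ⟨m, _, n, _, _, h⟩ := (minGap_isLeast (fun n => α * x n) hN).1
  rw [metricMinGap, h]
  exact abs_sub_round _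

/-- The gap decreases in N, so N inherits the bound at the largest power of two not exceeding it;
the factor 2^q lost is absorbed by q' < q. -/
theorem eventually_metricMinGap_lt_of_two_pow {x : ℕ → ℝ} {α q q' : ℝ} (hq : 0 ≤ q') (hqq : q' < q)
    (h : ∀ᶠ l : ℕ in atTop, metricMinGap x α (2 ^ l) < ((2 : ℝ) ^ l) ^ (-q)) :
    ∀ᶠ N : ℕ in atTop, metricMinGap x α N < (N : ℝ) ^ (-q') := by
  have hlog : Tendsto (fun N : ℕ => Nat.log 2 N) atTop atTop :=
    tendsto_atTop.2 fun b => by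
      filter_upwards [eventually_ge_atTop (2 ^ b)] with N hN using
        Nat.le_log_of_pow_le one_lt_two hN
  have hpow : ∀ᶠ X : ℝ in atTop, (2 : ℝ) ^ q * X ^ (-q) ≤ X ^ (-q') :=
    eventually_const_mul_rpow_le _ (by linarith)
  filter_upwards [hlog.eventually h, hlog.eventually_ge_atTop 1, eventually_ge_atTop 1,
    tendsto_natCast_atTop_atTop.eventually hpow] with N h1 h2 h3 h4
  set l := Nat.log 2 N
  have hle : 2 ^ l ≤ N := Nat.pow_log_le_self 2 (by omega)
  have hlt : N < 2 ^ (l + 1) := Nat.lt_pow_succ_log_self one_lt_two N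
  have h2l : 2 ≤ 2 ^ l := by
    calc 2 = 2 ^ 1 := rfl
      _ ≤ 2 ^ l := Nat.pow_le_pow_right two_pos h2
  refine ((metricMinGap_anti h2l hle).trans_lt h1).trans_le (le_trans ?_ h4)
  have hN0 : (0 : ℝ) < N := by exact_mod_cast h3
  have hlt' : (N : ℝ) / 2 ≤ 2 ^ l := by
    rw [div_le_iff₀ two_pos, ← pow_succ]
    exact_mod_cast hlt.le
  calc ((2 : ℝ) ^ l) ^ (-q) ≤ ((N : ℝ) / 2) ^ (-q) :=
        Real.rpow_le_rpow_of_nonpos (by positivity) hlt' (by linarith)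
    _ = 2 ^ q * (N : ℝ) ^ (-q) := by
        rw [Real.div_rpow hN0.le two_pos.le, Real.rpow_neg two_pos.le, div_inv_eq_mul, mul_comm]

/-- A power bound with arbitrarily small loss in the exponent is a bound with `o(1)` loss. -/
theorem exists_exponent_loss {f : ℕ → ℝ} {e : ℝ} (hf : ∀ᶠ N : ℕ in atTop, 0 ≤ f N)
    (h : ∀ k : ℕ, ∀ᶠ N : ℕ in atTop, f N < (N : ℝ) ^ (-(e - 1 / ((k : ℝ) + 1)))) :
    ∃ o : ℕ → ℝ, Tendsto o atTop (𝓝 0) ∧ ∀ᶠ N : ℕ in atTop, f N < 1 / (N : ℝ) ^ (e - o N) := by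
  have hlog : Tendsto (fun N : ℕ => Real.log N) atTop atTop :=
    Real.tendsto_log_atTop.comp tendsto_natCast_atTop_atTop
  have hinv : Tendsto (fun N : ℕ => 1 / Real.log N) atTop (𝓝 0) :=
    hlog.inv_tendsto_atTop.congr fun N => by simp
  -- The exact loss in the exponent, cut off at 0. The case f N = 0 is separate: there `Real.log 0 =
  -- 0` would give the loss e, which need not tend to 0.
  set g : ℕ → ℝ := fun N => if f N = 0 then 0 else max 0 (e + Real.log (f N) / Real.log N) with hg
  have hg0 : ∀ N, 0 ≤ g N := fun N => by
    simp only [hg]; split_ifs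
    · exact le_rfl
    · exact le_max_left _ _
  have hgt : Tendsto g atTop (𝓝 0) := by
    rw [Metric.tendsto_atTop']
    intro ε hε
    obtain ⟨k, hk⟩ := exists_nat_one_div_lt hε
    have hev : ∀ᶠ N : ℕ in atTop, dist (g N) 0 < ε := by
      filter_upwards [h k, hf, eventually_gt_atTop 1] with N h1 h2 h3
      rw [Real.dist_0_eq_abs, abs_of_nonneg (hg0 N)]
      refine lt_of_le_of_lt ?_ hk
      have hk0 : (0 : ℝ) ≤ 1 / ((k : ℝ) + 1) := by positivity
      simp only [hg]
      split_ifs with h0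
      · exact hk0
      · refine max_le hk0 ?_
        have hfp : 0 < f N := lt_of_le_of_ne h2 (Ne.symm h0)
        have hN1 : (1 : ℝ) < N := by exact_mod_cast h3
        have hl0 : 0 < Real.log N := Real.log_pos hN1
        have h5 := Real.log_lt_log hfp h1
        rw [Real.log_rpow (by linarith)] at h5
        have h6 : Real.log (f N) / Real.log N ≤ -(e - 1 / ((k : ℝ) + 1)) := by
          rw [div_le_iff₀ hl0]; exact h5.le
        linarith
    obtain ⟨N₀, hN₀⟩ := eventually_atTop.1 hev
    exact ⟨N₀, fun N hN => hN₀ N hN.le⟩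
  -- The extra 1/log N multiplies the bound by the constant exp 1, which makes the inequality
  -- strict.
  refine ⟨fun N => g N + 1 / Real.log N, by simpa using hgt.add hinv, ?_⟩
  filter_upwards [hf, eventually_gt_atTop 1] with N h2 h3
  have hN1 : (1 : ℝ) < N := by exact_mod_cast h3
  have hN0 : (0 : ℝ) < N := by linarith
  have hl0 : 0 < Real.log N := Real.log_pos hN1
  rw [one_div ((N : ℝ) ^ _), ← Real.rpow_neg hN0.le]
  by_cases h0 : f N = 0
  · rw [h0]; positivity
  · have hfp : 0 < f N := lt_of_le_of_ne h2 (Ne.symm h0)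
    have hgN : e + Real.log (f N) / Real.log N ≤ g N := by
      simp only [hg, if_neg h0]
      exact le_max_right _ _
    rw [← Real.log_lt_log_iff hfp (by positivity), Real.log_rpow hN0, ← div_lt_iff₀ hl0]
    have : 0 < 1 / Real.log N := by positivity
    linarith

theorem aeMinGapBound_of_zetaMomentBound {x : ℕ → ℝ}
    (hgap : ∃ c : ℝ, 0 < c ∧ ∀ n : ℕ, 1 ≤ n → c ≤ x (n + 1) - x n)
    (henergy : ∃ o : ℕ → ℝ, Tendsto o atTop (𝓝 0) ∧
      ∀ᶠ N : ℕ in atTop, (addEnergy x N : ℝ) = (N : ℝ) ^ (2 + o N))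
    {κ m : ℝ} (hκ : 2 ≤ κ) (hζ : ZetaMomentBound κ m) :
    AEMinGapBound x ((2 * κ - 4) / (κ + 4 * m)) := by
  -- For κ = 2 the exponent is 0 and the trivial bound 1/2 < 1 suffices; the main argument needs a
  -- positive exponent.
  rcases hκ.eq_or_lt with rfl | hκ
  · refine Eventually.of_forall fun α => ⟨fun _ => 0, tendsto_const_nhds, ?_⟩
    filter_upwards [eventually_ge_atTop 2] with N hN
    have := metricMinGap_le_half x α hN
    norm_num
    linarith
  have hm := hζ.nonneg hκ.le
  set e := (2 * κ - 4) / (κ + 4 * m) with he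
  have he0 : 0 < e := div_pos (by linarith) (by linarith)
  have hall : ∀ᵐ α : ℝ ∂volume, ∀ k : ℕ, ∀ᶠ N : ℕ in atTop,
      metricMinGap x α N < (N : ℝ) ^ (-(e - 1 / ((k : ℝ) + 1))) := by
    rw [ae_all_iff]
    intro k
    have hk : (0 : ℝ) < 1 / ((k : ℝ) + 1) := by positivity
    -- One η is lost in the measure bound and another in passing from powers of two to all N; the
    -- cap by e keeps e - 2η nonnegative.
    set η := min (1 / ((k : ℝ) + 1)) e / 2 with hη
    have hmin : 0 < min (1 / ((k : ℝ) + 1)) e := lt_min hk he0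
    have hη0 : 0 < η := by positivity
    have hη1 : 2 * η ≤ 1 / ((k : ℝ) + 1) := by
      rw [hη]; linarith [min_le_left (1 / ((k : ℝ) + 1)) e]
    have hη2 : 2 * η ≤ e := by rw [hη]; linarith [min_le_right (1 / ((k : ℝ) + 1)) e]
    have h1 := ae_eventually_metricMinGap_two_pow_lt hgap henergy hκ hζ hη0 (by linarith)
    filter_upwards [h1] with α hα
    have h2 := eventually_metricMinGap_lt_of_two_pow (q' := e - 2 * η) (by linarith)
      (by linarith) hα
    filter_upwards [h2, eventually_ge_atTop 1] with N h3 h4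
    refine h3.trans_le (Real.rpow_le_rpow_of_exponent_le (by exact_mod_cast h4) (by linarith))
  filter_upwards [hall] with α hα
  refine exists_exponent_loss ?_ hα
  filter_upwards [eventually_ge_atTop 2] with N hN using metricMinGap_nonneg x α hN

theorem theorem1p4 (x : ℕ → ℝ)
    (hpos : ∀ n : ℕ, 1 ≤ n → 0 < x n)
    (hgap : ∃ c : ℝ, 0 < c ∧ ∀ n : ℕ, 1 ≤ n → c ≤ x (n + 1) - x n)
    (henergy : ∃ o : ℕ → ℝ, Tendsto o atTop (𝓝 0) ∧
      ∀ᶠ N : ℕ in atTop, (addEnergy x N : ℝ) = (N : ℝ) ^ (2 + o N)) :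
    (∀ κ m : ℝ, 2 ≤ κ → ZetaMomentBound κ m →
      AEMinGapBound x ((2 * κ - 4) / (κ + 4 * m))) ∧
    (ZetaMomentBound 12 1 → AEMinGapBound x (5 / 4)) := by
  refine ⟨fun κ m hκ hζ => aeMinGapBound_of_zetaMomentBound hgap henergy hκ hζ, fun hζ => ?_⟩
  have h := aeMinGapBound_of_zetaMomentBound hgap henergy (by norm_num) hζ
  norm_num at h ⊢
  exact h
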